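/- Let $\{P_\theta:\theta\in\Theta\}$ be a nonempty family of probability measures on a measurable space $(\Omega,\mathcal F)$, let $E_\theta$ be the expectation under $P_\theta$, and let $\mathbb E[X]:=\sup_{\theta\in\Theta}E_\theta[X]$. Let $n\ge 1$ and let $X_1,\dots,X_n$ be real random variables on $(\Omega,\mathcal F)$ that are i.i.d. under $\mathbb E$, which means that for all bounded continuous functions $\psi$: $$\mathbb E[\psi(X_i)]=\mathbb E[\psi(X_1)]\quad(1\le i\le n),$$ $$\mathbb E[\psi(X_1,\dots,X_i,X_{i+1})]=\mathbb E\Big[\big\{\mathbb E[\psi(x_1,\dots,x_i,X_{i+1})]\big\}_{(x_1,\dots,x_i)=(X_1,\dots,X_i)}\Big]\quad(1\le i<n).$$ Suppose that $\mathbb E[|X_1|^3]<\infty$ and that the mean is certain, $\mathbb E[X_1]=-\mathbb E[-X_1]=:\mu$. Let $\overline\sigma,\underline\sigma\ge 0$ be given by $$\overline\sigma^2:=\mathbb E[(X_1-\mu)^2],\qquad \underline\sigma^2:=-\mathbb E[-(X_1-\mu)^2].$$ Let $\varphi:\mathbb R\to\mathbb R$ be Lipschitz, let $\|\varphi'\|$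 be the supremum of $|\varphi'|$ over the points where $\varphi$ is differentiable, and let $Z$ be a standard Gaussian random variable with (ordinary) expectation $E$. If $\varphi$ is convex and $\overline\sigma>0$, then $$\Big|\mathbb E\Big[\varphi\Big(\frac{\sum_{i=1}^n(X_i-\mu)}{\overline\sigma\sqrt n}\Big)\Big]-E[\varphi(Z)]\Big|\le\frac{\log n+1}{\sqrt n}\Big(2+\mathbb E\Big[\Big|\frac{X_1-\mu}{\overline\sigma}\Big|^3\Big]\Big)\|\varphi'\|.$$ If $\varphi$ is concave and $\underline\sigma>0$, then $$\Big|\mathbb E\Big[\varphi\Big(\frac{\sum_{i=1}^n(X_i-\mu)}{\underline\sigma\sqrt n}\Big)\Big]-E[\varphi(Z)]\Big|\le\frac{\log n+1}{\sqrt n}\Big(\frac{2\overline\sigma}{\underline\sigma}+\mathbb E\Big[\Big|\frac{X_1-\mu}{\underline\sigma}\Big|^3\Big]\Big)\|\varphi'\|.$$ -/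

import Mathlib

open MeasureTheory ProbabilityTheory
open scoped ENNReal BoundedContinuousFunction

namespace SublinearExpectation

/-- The sublinear expectation `𝔼[X] = sup_θ E_θ[X]` attached to a family of measures `P θ`.
It is meant for `X` that is integrable under every `P θ`, with `θ ↦ E_θ[X]` bounded above;
this is the case for every random variable to which it is applied below. -/
noncomputable def upperExp {Ω Θ : Type*} [MeasurableSpace Ω] (P : Θ → Measure Ω)
    (X : Ω → ℝ) : ℝ :=
  ⨆ θ, ∫ ω, X ω ∂(P θ)

/-- `X` and `Y` are identically distributed under `𝔼`: `𝔼[φ(X)] = 𝔼[φ(Y)]` for every bounded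
continuous `φ`. -/
def IdentDistributed {Ω Θ E : Type*} [MeasurableSpace Ω] [TopologicalSpace E]
    (P : Θ → Measure Ω) (X Y : Ω → E) : Prop :=
  ∀ φ : E →ᵇ ℝ, upperExp P (fun ω => φ (X ω)) = upperExp P (fun ω => φ (Y ω))

/-- `Y` is independent of `X` under `𝔼` (not a symmetric relation):
`𝔼[φ(X, Y)] = 𝔼[ 𝔼[φ(x, Y)] at x = X ]` for every bounded continuous `φ`.
The function `x ↦ 𝔼[φ(x, Y)]` is bounded and lower semicontinuous, hence Borel. -/
def IndependentOf {Ω Θ E F : Type*} [MeasurableSpace Ω] [TopologicalSpace E]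
    [TopologicalSpace F] (P : Θ → Measure Ω) (Y : Ω → F) (X : Ω → E) : Prop :=
  ∀ φ : (E × F) →ᵇ ℝ,
    upperExp P (fun ω => φ (X ω, Y ω)) =
      upperExp P (fun ω => upperExp P (fun ω' => φ (X ω, Y ω')))

/-- The first `n` variables `X 0, …, X (n - 1)` are i.i.d. under `𝔼`: each is distributed as
`X 0`, and each `X i` with `1 ≤ i` is independent of the vector `(X 0, …, X (i - 1))`. -/
structure IsIID {Ω Θ : Type*} [MeasurableSpace Ω] (P : Θ → Measure Ω) (n : ℕ)
    (X : ℕ → Ω → ℝ) : Prop where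
  ident : ∀ i, i < n → IdentDistributed P (X i) (X 0)
  indep : ∀ i, 1 ≤ i → i < n → IndependentOf P (X i) (fun ω (j : Fin i) => X j ω)

/-- The supremum norm `‖φ'‖` of the derivative of a Lipschitz function `φ : ℝ → ℝ`. The derivative
exists almost everywhere; the points of non-differentiability contribute `|deriv φ x| = 0`, so this
is the supremum of `|φ'|` over the points where `φ'` exists. -/
noncomputable def derivSupNorm (φ : ℝ → ℝ) : ℝ :=
  ⨆ x, |deriv φ x|

end SublinearExpectation

/-! The proof is a Lindeberg replacement in which convexity makes the sublinear problem linear. Let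
`u` be the average of `φ` over a centred Gaussian of variance `v > 0`. It is smooth, and `u''` is
nonnegative if `φ` is convex, nonpositive if `φ` is concave (`gaussianSmoothDeriv2_nonneg`,
`gaussianSmoothDeriv2_nonpos`). Hence `𝔼[u''(x) (X₁ - μ)²]` equals `u''(x)` times the upper variance
in the convex case and the lower variance in the concave case, so a single Gaussian serves as the
limit.

Rescale so that this variance is 1, and let `a k` be the upper expectation of `φ` smoothed with
variance `(n - k) / n`, evaluated at the sum of the first `k` variables divided by `√n`. Then `a n`
is the quantity to estimate and `a 0 = E[φ(Z)]`. By independence, `a (k + 1)` and `a k` differ by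
one step taken with `X₁` or with a Gaussian (`IsIID.upperExp_sum_succ`, `gaussianSmooth_add`). Both
steps have the same second order Taylor expansion: the linear terms vanish because the mean is
certain, and the quadratic terms agree. The remainders are third order, and `u''` has Lipschitz
constant `2 * K / v` (`abs_gaussianSmoothDeriv2_sub_le`), so their sum is harmonic and yields the
logarithm. The last step has no smoothing left and is bounded by the Lipschitz constant alone.

Independence is given only for bounded continuous functions; truncation and uniform second moments
extend it to Lipschitz ones (`upperExp_add_eq_upperExp_stepExp`). Finally `‖φ'‖` is itself a
Lipschitz constant of `φ` (`lipschitzWith_derivSupNorm`). -/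

namespace SublinearExpectation

open scoped NNReal

/-! ### Functions of at most exponential growth -/

/-- A measurable function bounded by `C * exp (c * |z|)`. -/
def ExpGrowth (f : ℝ → ℝ) : Prop :=
  Measurable f ∧ ∃ C c : ℝ, ∀ z, |f z| ≤ C * Real.exp (c * |z|)

lemma ExpGrowth.mul {f g : ℝ → ℝ} (hf : ExpGrowth f) (hg : ExpGrowth g) :
    ExpGrowth (fun z => f z * g z) := by
  obtain ⟨hfm, C, c, hC⟩ := hf
  obtain ⟨hgm, D, d, hD⟩ := hg
  refine ⟨hfm.mul hgm, C * D, c + d, fun z => ?_⟩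
  rw [abs_mul, add_mul, Real.exp_add]
  calc |f z| * |g z| ≤ (C * Real.exp (c * |z|)) * (D * Real.exp (d * |z|)) :=
        mul_le_mul (hC z) (hD z) (abs_nonneg _) ((abs_nonneg _).trans (hC z))
    _ = _ := by ring

lemma ExpGrowth.abs {f : ℝ → ℝ} (hf : ExpGrowth f) : ExpGrowth (fun z => |f z|) :=
  ⟨hf.1.abs, by simpa using hf.2⟩

lemma ExpGrowth.id : ExpGrowth (fun z => z) :=
  ⟨measurable_id, 1, 1, fun z => by linarith [Real.add_one_le_exp (1 * |z|)]⟩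

lemma ExpGrowth.const (a : ℝ) : ExpGrowth (fun _ => a) :=
  ⟨measurable_const, |a|, 0, fun z => by simp⟩

lemma ExpGrowth.exp_abs : ExpGrowth (fun z => Real.exp |z|) :=
  ⟨by fun_prop, 1, 1, fun z => by simp⟩

lemma ExpGrowth.pow (k : ℕ) : ExpGrowth (fun z => z ^ k) := by
  induction k with
  | zero => simpa using ExpGrowth.const 1
  | succ k ih => simpa [pow_succ] using ih.mul ExpGrowth.id

lemma ExpGrowth.of_lipschitz {K : ℝ≥0} {φ : ℝ → ℝ} (hφ : LipschitzWith K φ) (x : ℝ) :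
    ExpGrowth (fun z => φ (x + z)) := by
  refine ⟨(hφ.continuous.comp (by fun_prop)).measurable, |φ x| + K, 1, fun z => ?_⟩
  have h1 : |φ (x + z) - φ x| ≤ K * |z| := by
    simpa [Real.dist_eq] using hφ.dist_le_mul (x + z) x
  have h2 : |φ (x + z)| ≤ |φ x| + K * |z| := by
    have := abs_sub_abs_le_abs_sub (φ (x + z)) (φ x)
    linarith
  have h3 := Real.add_one_le_exp (1 * |z|)
  have h4 : 1 ≤ Real.exp (1 * |z|) := Real.one_le_exp (by positivity)
  have h5 : |z| ≤ Real.exp (1 * |z|) := by linarith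
  calc |φ (x + z)| ≤ |φ x| * 1 + K * |z| := by linarith
    _ ≤ |φ x| * Real.exp (1 * |z|) + K * Real.exp (1 * |z|) := by gcongr
    _ = _ := by ring

lemma ExpGrowth.integrable {f : ℝ → ℝ} (hf : ExpGrowth f) (v : ℝ≥0) :
    Integrable f (gaussianReal 0 v) := by
  obtain ⟨hfm, C, c, hC⟩ := hf
  have h := ((integrable_exp_mul_gaussianReal (μ := 0) (v := v) c).add
    (integrable_exp_mul_gaussianReal (μ := 0) (v := v) (-c))).const_mul |C|
  refine h.mono' hfm.aestronglyMeasurable (ae_of_all _ fun z => ?_)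
  rw [Real.norm_eq_abs]
  refine (hC z).trans ?_
  simp only [Pi.add_apply]
  have hle : Real.exp (c * |z|) ≤ Real.exp (c * z) + Real.exp (-c * z) := by
    rcases abs_cases z with ⟨h, _⟩ | ⟨h, _⟩ <;> rw [h]
    · linarith [Real.exp_pos (-c * z)]
    · have := Real.exp_pos (c * z)
      have e : c * -z = -c * z := by ring
      rw [e]; linarith
  calc C * Real.exp (c * |z|) ≤ |C| * Real.exp (c * |z|) := by gcongr; exact le_abs_self C
    _ ≤ _ := by gcongr

/-! ### Differentiation of Gaussian averages with respect to a shift -/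

/-- Cameron–Martin shift: the translation moves from `f` to the density, so the integral can be
differentiated in `a` without any smoothness of `f`. -/
lemma integral_add_gaussianReal {v : ℝ≥0} (hv : v ≠ 0) (f : ℝ → ℝ) (a : ℝ) :
    ∫ z, f (z + a) ∂(gaussianReal 0 v)
      = Real.exp (-a ^ 2 / (2 * v)) * ∫ z, f z * Real.exp (a / v * z) ∂(gaussianReal 0 v) := by
  have hv' : (v : ℝ) ≠ 0 := by exact_mod_cast hv
  rw [integral_gaussianReal_eq_integral_smul hv, integral_gaussianReal_eq_integral_smul hv,
    ← integral_const_mul,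
    ← integral_add_right_eq_self (μ := volume)
      (fun z => Real.exp (-a ^ 2 / (2 * v)) *
        (gaussianPDFReal 0 v z • (f z * Real.exp (a / v * z)))) a]
  refine integral_congr_ae (ae_of_all _ fun z => ?_)
  simp only [gaussianPDFReal, smul_eq_mul, sub_zero]
  have h : Real.exp (-z ^ 2 / (2 * v))
      = Real.exp (-a ^ 2 / (2 * v)) * Real.exp (-(z + a) ^ 2 / (2 * v))
        * Real.exp (a / v * (z + a)) := by
    rw [← Real.exp_add, ← Real.exp_add]
    congr 1
    field_simp
    ring
  rw [h]; ring

lemma hasDerivAt_integral_add_gaussianReal {v : ℝ≥0} (hv : v ≠ 0) {f : ℝ → ℝ}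
    (hf : ExpGrowth f) :
    HasDerivAt (fun a => ∫ z, f (z + a) ∂(gaussianReal 0 v))
      ((∫ z, f z * z ∂(gaussianReal 0 v)) / v) 0 := by
  have hvpos : (0 : ℝ) < v := by exact_mod_cast pos_iff_ne_zero.mpr hv
  have hbound : Integrable (fun z => |f z| * (|z| * (v : ℝ)⁻¹ * Real.exp |z|))
      (gaussianReal 0 v) :=
    (hf.abs.mul ((ExpGrowth.id.abs.mul (ExpGrowth.const (v : ℝ)⁻¹)).mul
      ExpGrowth.exp_abs)).integrable v
  have hfm := hf.1
  have h1 : HasDerivAt (fun a => ∫ z, f z * Real.exp (a / v * z) ∂(gaussianReal 0 v))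
      (∫ z, f z * (z / v * Real.exp (0 / v * z)) ∂(gaussianReal 0 v)) 0 := by
    refine (hasDerivAt_integral_of_dominated_loc_of_deriv_le
      (F := fun a z => f z * Real.exp (a / v * z))
      (F' := fun a z => f z * (z / v * Real.exp (a / v * z)))
      (Metric.ball_mem_nhds (0 : ℝ) hvpos) ?_ ?_ ?_ ?_ hbound ?_).2
    · exact Filter.Eventually.of_forall fun a => by
        have : Measurable (fun z => f z * Real.exp (a / v * z)) := by fun_prop
        exact this.aestronglyMeasurable
    · simpa using hf.integrable v
    · have : Measurable (fun z => f z * (z / v * Real.exp (0 / v * z))) := by fun_prop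
      exact this.aestronglyMeasurable
    · refine ae_of_all _ fun z a ha => ?_
      rw [Real.norm_eq_abs, abs_mul, abs_mul, abs_div, abs_of_pos hvpos,
        abs_of_pos (Real.exp_pos _), div_eq_mul_inv |z|]
      -- The ball of radius `v` makes the exponential factor at most `exp |z|`, uniformly in `a`.
      have ha' : |a / v| ≤ 1 := by
        rw [abs_div, abs_of_pos hvpos, div_le_one hvpos]
        simpa [Real.dist_eq] using (Metric.mem_ball.mp ha).le
      have : a / v * z ≤ |z| := by
        calc a / v * z ≤ |a / v * z| := le_abs_self _
          _ = |a / v| * |z| := abs_mul _ _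
          _ ≤ 1 * |z| := by gcongr
          _ = |z| := one_mul _
      gcongr
    · refine ae_of_all _ fun z a _ => ?_
      have h := (((hasDerivAt_id a).div_const (v : ℝ)).mul_const z).exp.const_mul (f z)
      refine h.congr_deriv ?_
      simp only [id]
      ring
  have h2 : HasDerivAt (fun a : ℝ => Real.exp (-a ^ 2 / (2 * v))) 0 0 := by
    have h := (((hasDerivAt_pow 2 (0 : ℝ)).fun_neg).div_const (2 * (v : ℝ))).exp
    simpa using h
  have h3 := h2.mul h1
  have e : (fun a => ∫ z, f (z + a) ∂(gaussianReal 0 v))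
      = (fun a : ℝ => Real.exp (-a ^ 2 / (2 * v)))
        * fun a => ∫ z, f z * Real.exp (a / v * z) ∂(gaussianReal 0 v) := by
    funext a
    exact integral_add_gaussianReal hv f a
  rw [e]
  refine h3.congr_deriv ?_
  simp only [zero_mul, zero_add, zero_div, Real.exp_zero, mul_one, ne_eq, OfNat.ofNat_ne_zero,
    not_false_eq_true, zero_pow, neg_zero, one_mul]
  rw [← integral_div]
  congr 1
  funext z
  ring

/-! ### Moments of the centred Gaussian -/

lemma integral_sq_gaussianReal (v : ℝ≥0) : ∫ z, z ^ 2 ∂(gaussianReal 0 v) = v := by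
  have h := variance_fun_id_gaussianReal (μ := 0) (v := v)
  rw [variance_eq_integral (by fun_prop)] at h
  simpa [integral_id_gaussianReal] using h

/-- The derivative at `a = 0` of the integral of `(z + a) ^ 3` is computed twice: by the shift
formula and by expanding the cube. -/
lemma integral_pow_four_gaussianReal {v : ℝ≥0} (hv : v ≠ 0) :
    ∫ z, z ^ 4 ∂(gaussianReal 0 v) = 3 * (v : ℝ) ^ 2 := by
  have hvpos : (0 : ℝ) < v := by exact_mod_cast pos_iff_ne_zero.mpr hv
  have h1 := hasDerivAt_integral_add_gaussianReal hv (ExpGrowth.pow 3)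
  have e : (fun a => ∫ z, (z + a) ^ 3 ∂(gaussianReal 0 v))
      = fun a : ℝ => (∫ z, z ^ 3 ∂(gaussianReal 0 v)) + 3 * (v : ℝ) * a + a ^ 3 := by
    funext a
    have i3 := (ExpGrowth.pow 3).integrable v
    have i2 := ((ExpGrowth.pow 2).integrable v).const_mul (3 * a)
    have i1 := (ExpGrowth.id.integrable v).const_mul (3 * a ^ 2)
    have : (fun z : ℝ => (z + a) ^ 3) = fun z => ((z ^ 3 + 3 * a * z ^ 2) + 3 * a ^ 2 * z)
        + a ^ 3 := by
      funext z; ring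
    have i32 : Integrable (fun z : ℝ => z ^ 3 + 3 * a * z ^ 2) (gaussianReal 0 v) := i3.add i2
    have i321 : Integrable (fun z : ℝ => z ^ 3 + 3 * a * z ^ 2 + 3 * a ^ 2 * z)
        (gaussianReal 0 v) := i32.add i1
    rw [this, integral_add i321 (integrable_const _), integral_add i32 i1, integral_add i3 i2, integral_const_mul, integral_const_mul,
      integral_sq_gaussianReal, integral_id_gaussianReal]
    simp
    ring
  rw [e] at h1
  have h2 : HasDerivAt
      (fun a : ℝ => (∫ z, z ^ 3 ∂(gaussianReal 0 v)) + 3 * (v : ℝ) * a + a ^ 3) (3 * (v : ℝ)) 0 := by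
    have h := (((hasDerivAt_id (0 : ℝ)).const_mul (3 * (v : ℝ))).const_add
      (∫ z, z ^ 3 ∂(gaussianReal 0 v))).add (hasDerivAt_pow 3 (0 : ℝ))
    refine h.congr_deriv ?_
    simp
  have h3 := h1.unique h2
  rw [div_eq_iff hvpos.ne'] at h3
  have : (fun z : ℝ => z ^ 4) = fun z => z ^ 3 * z := by funext z; ring
  rw [this, h3]; ring

lemma integral_abs_gaussianReal_le {v : ℝ≥0} {δ : ℝ} (hδ : 0 < δ) (hv : (v : ℝ) = δ ^ 2) :
    ∫ z, |z| ∂(gaussianReal 0 v) ≤ δ := by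
  have i2 := (((ExpGrowth.pow 2).integrable v).div_const (2 * δ))
  calc ∫ z, |z| ∂(gaussianReal 0 v)
      ≤ ∫ z, (z ^ 2 / (2 * δ) + δ / 2) ∂(gaussianReal 0 v) := by
        refine integral_mono (ExpGrowth.id.abs.integrable v) (i2.add (integrable_const _))
          fun z => ?_
        have : z ^ 2 / (2 * δ) + δ / 2 - |z| = (|z| - δ) ^ 2 / (2 * δ) := by
          rw [← sq_abs z]; field_simp; ring
        have h : 0 ≤ (|z| - δ) ^ 2 / (2 * δ) := by positivity
        show |z| ≤ z ^ 2 / (2 * δ) + δ / 2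
        linarith
    _ = δ := by
        rw [integral_add i2 (integrable_const _), integral_div, integral_sq_gaussianReal, hv]
        simp
        field_simp
        ring

/-- By AM-GM, `|z|³ ≤ δ z² / 2 + z⁴ / (2δ)`; the moments `δ²` and `3δ⁴` give `δ³/2 + 3δ³/2`. -/
lemma integral_abs_cube_gaussianReal_le {v : ℝ≥0} {δ : ℝ} (hδ : 0 < δ) (hv : (v : ℝ) = δ ^ 2) :
    ∫ z, |z| ^ 3 ∂(gaussianReal 0 v) ≤ 2 * δ ^ 3 := by
  have hv0 : v ≠ 0 := by
    rintro rfl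
    have : 0 < δ ^ 2 := by positivity
    simp at hv; linarith
  have i2 := (((ExpGrowth.pow 2).integrable v).const_mul (δ / 2))
  have i4 := (((ExpGrowth.pow 4).integrable v).div_const (2 * δ))
  have i3 : Integrable (fun z : ℝ => |z| ^ 3) (gaussianReal 0 v) := by
    simpa [abs_pow] using (ExpGrowth.pow 3).abs.integrable v
  calc ∫ z, |z| ^ 3 ∂(gaussianReal 0 v)
      ≤ ∫ z, (δ / 2 * z ^ 2 + z ^ 4 / (2 * δ)) ∂(gaussianReal 0 v) := by
        refine integral_mono i3 (i2.add i4) fun z => ?_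
        have e4 : z ^ 4 = |z| ^ 4 := by rw [← abs_pow]; exact (abs_of_nonneg (by positivity)).symm
        have : δ / 2 * z ^ 2 + z ^ 4 / (2 * δ) - |z| ^ 3 = |z| ^ 2 * (|z| - δ) ^ 2 / (2 * δ) := by
          rw [e4, ← sq_abs z]; field_simp; ring
        have h : 0 ≤ |z| ^ 2 * (|z| - δ) ^ 2 / (2 * δ) := by positivity
        show |z| ^ 3 ≤ δ / 2 * z ^ 2 + z ^ 4 / (2 * δ)
        linarith
    _ = 2 * δ ^ 3 := by
        rw [integral_add i2 i4, integral_div, integral_const_mul, integral_sq_gaussianReal,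
          integral_pow_four_gaussianReal hv0, hv]
        field_simp
        ring

/-! ### Gaussian smoothing of a Lipschitz function -/

/-- The average of `φ` over a centred Gaussian of variance `v` around `x`. -/
noncomputable def gaussianSmooth (φ : ℝ → ℝ) (v : ℝ≥0) (x : ℝ) : ℝ :=
  ∫ z, φ (x + z) ∂(gaussianReal 0 v)

/-- The first derivative of `gaussianSmooth φ v`. -/
noncomputable def gaussianSmoothDeriv (φ : ℝ → ℝ) (v : ℝ≥0) (x : ℝ) : ℝ :=
  (∫ z, φ (x + z) * z ∂(gaussianReal 0 v)) / v

/-- The second derivative of `gaussianSmooth φ v`. -/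
noncomputable def gaussianSmoothDeriv2 (φ : ℝ → ℝ) (v : ℝ≥0) (x : ℝ) : ℝ :=
  (∫ z, φ (x + z) * (z ^ 2 - v) ∂(gaussianReal 0 v)) / v ^ 2

section Smoothing

variable {K v : ℝ≥0} {φ : ℝ → ℝ}

lemma lipschitzWith_gaussianSmooth (hφ : LipschitzWith K φ) (v : ℝ≥0) :
    LipschitzWith K (gaussianSmooth φ v) := by
  refine LipschitzWith.of_dist_le_mul fun x y => ?_
  rw [Real.dist_eq, gaussianSmooth, gaussianSmooth,
    ← integral_sub ((ExpGrowth.of_lipschitz hφ x).integrable v)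
      ((ExpGrowth.of_lipschitz hφ y).integrable v), ← Real.norm_eq_abs]
  refine (norm_integral_le_of_norm_le_const (C := K * dist x y) (ae_of_all _ fun z => ?_)).trans ?_
  · simpa [Real.dist_eq] using hφ.dist_le_mul (x + z) (y + z)
  · simp

lemma gaussianSmooth_zero (φ : ℝ → ℝ) : gaussianSmooth φ 0 = φ := by
  funext x
  simp [gaussianSmooth]

lemma gaussianSmooth_add (hφ : LipschitzWith K φ) (v w : ℝ≥0) (x : ℝ) :
    gaussianSmooth φ (w + v) x = ∫ z, gaussianSmooth φ v (x + z) ∂(gaussianReal 0 w) := by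
  have hc : (gaussianReal 0 w) ∗ (gaussianReal 0 v) = gaussianReal 0 (w + v) := by
    rw [gaussianReal_conv_gaussianReal, add_zero]
  have hint : Integrable (fun z => φ (x + z)) ((gaussianReal 0 w) ∗ (gaussianReal 0 v)) := by
    rw [hc]; exact (ExpGrowth.of_lipschitz hφ x).integrable _
  unfold gaussianSmooth
  rw [← hc, MeasureTheory.integral_conv hint]
  simp only [add_assoc]

lemma hasDerivAt_gaussianSmooth (hv : v ≠ 0) (hφ : LipschitzWith K φ) (x : ℝ) :
    HasDerivAt (gaussianSmooth φ v) (gaussianSmoothDeriv φ v x) x := by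
  have h := hasDerivAt_integral_add_gaussianReal hv (ExpGrowth.of_lipschitz hφ x)
  have h' := HasDerivAt.comp_sub_const (f := fun a => ∫ z, φ (x + (z + a)) ∂(gaussianReal 0 v))
    x x (by rw [sub_self]; exact h)
  refine h'.congr_of_eventuallyEq (Filter.Eventually.of_forall fun y => ?_)
  simp only [gaussianSmooth]
  congr 1
  funext z
  congr 1
  ring

/-- With `f z = φ (x + z)` and `a = y - x`, the integrand `φ (y + z) * z` is `f (z + a) * (z + a) -
a * f (z + a)`, so the shift derivative applies to both terms. -/
lemma hasDerivAt_gaussianSmoothDeriv (hv : v ≠ 0) (hφ : LipschitzWith K φ) (x : ℝ) :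
    HasDerivAt (gaussianSmoothDeriv φ v) (gaussianSmoothDeriv2 φ v x) x := by
  have hvpos : (0 : ℝ) < v := by exact_mod_cast pos_iff_ne_zero.mpr hv
  have hg := ExpGrowth.of_lipschitz hφ x
  have h1 := hasDerivAt_integral_add_gaussianReal hv (hg.mul ExpGrowth.id)
  have h2 := (hasDerivAt_id (0 : ℝ)).mul (hasDerivAt_integral_add_gaussianReal hv hg)
  have h3 := (h1.sub h2).div_const (v : ℝ)
  have h := HasDerivAt.comp_sub_const x x (by rw [sub_self]; exact h3)
  refine (h.congr_of_eventuallyEq (Filter.Eventually.of_forall fun y => ?_)).congr_deriv ?_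
  · have i1 := ((ExpGrowth.of_lipschitz hφ y).mul ExpGrowth.id).integrable v
    have i2 := ((ExpGrowth.of_lipschitz hφ y).integrable v).const_mul (y - x)
    have e1 : (fun z => φ (x + (z + (y - x))) * (z + (y - x)))
        = fun z => φ (y + z) * z + (y - x) * φ (y + z) := by
      funext z
      rw [show x + (z + (y - x)) = y + z by ring]; ring
    have e2 : (fun z => φ (x + (z + (y - x)))) = fun z => φ (y + z) := by
      funext z
      rw [show x + (z + (y - x)) = y + z by ring]
    simp only [gaussianSmoothDeriv, Pi.sub_apply, Pi.mul_apply, id, e1, e2]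
    rw [integral_add i1 i2, integral_const_mul]
    ring
  · have i1 := (hg.mul (ExpGrowth.pow 2)).integrable v
    have i2 := (hg.integrable v).mul_const (v : ℝ)
    simp only [gaussianSmoothDeriv2, id, zero_mul, add_zero, one_mul, mul_sub]
    rw [integral_sub i1 i2, integral_mul_const]
    have : (fun z => φ (x + z) * z * z) = fun z => φ (x + z) * z ^ 2 := by funext z; ring
    rw [this]
    field_simp

/-- Only `φ` depends on `x`, and `|z² - v| ≤ z² + v` has integral at most `2v`; division by `v²`
leaves `2 * K / v`. -/
lemma abs_gaussianSmoothDeriv2_sub_le (hv : v ≠ 0) (hφ : LipschitzWith K φ) (x y : ℝ) :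
    |gaussianSmoothDeriv2 φ v x - gaussianSmoothDeriv2 φ v y| ≤ 2 * K / v * |x - y| := by
  have hvpos : (0 : ℝ) < v := by exact_mod_cast pos_iff_ne_zero.mpr hv
  have hq : ExpGrowth (fun z => z ^ 2 - (v : ℝ)) := by
    obtain ⟨hm, C, c, h⟩ := ExpGrowth.pow 2
    refine ⟨by fun_prop, C + v, max c 0, fun z => ?_⟩
    have h1 : 1 ≤ Real.exp (max c 0 * |z|) := Real.one_le_exp (by positivity)
    have hC : 0 ≤ C := by simpa using h 0
    calc |z ^ 2 - (v : ℝ)| ≤ |z ^ 2| + |(v : ℝ)| := abs_sub _ _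
      _ ≤ C * Real.exp (c * |z|) + v * 1 := by
        rw [abs_of_pos hvpos, mul_one]; linarith [h z]
      _ ≤ C * Real.exp (max c 0 * |z|) + v * Real.exp (max c 0 * |z|) := by
        gcongr; exact le_max_left _ _
      _ = _ := by ring
  have i1 := ((ExpGrowth.of_lipschitz hφ x).mul hq).integrable v
  have i2 := ((ExpGrowth.of_lipschitz hφ y).mul hq).integrable v
  have i3 := (((ExpGrowth.pow 2).integrable v).add (integrable_const (v : ℝ))).const_mul
    (K * |x - y|)
  rw [gaussianSmoothDeriv2, gaussianSmoothDeriv2, ← sub_div, ← integral_sub i1 i2, abs_div,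
    abs_of_pos (by positivity : (0 : ℝ) < v ^ 2), div_le_iff₀ (by positivity)]
  calc |∫ z, (φ (x + z) * (z ^ 2 - v) - φ (y + z) * (z ^ 2 - v)) ∂(gaussianReal 0 v)|
      ≤ ∫ z, |φ (x + z) * (z ^ 2 - v) - φ (y + z) * (z ^ 2 - v)| ∂(gaussianReal 0 v) :=
        abs_integral_le_integral_abs
    _ ≤ ∫ z, K * |x - y| * (z ^ 2 + v) ∂(gaussianReal 0 v) := by
        refine integral_mono (i1.sub i2).abs i3 fun z => ?_
        show |φ (x + z) * (z ^ 2 - v) - φ (y + z) * (z ^ 2 - v)| ≤ K * |x - y| * (z ^ 2 + v)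
        rw [← sub_mul, abs_mul]
        have h1 : |φ (x + z) - φ (y + z)| ≤ K * |x - y| := by
          simpa [Real.dist_eq] using hφ.dist_le_mul (x + z) (y + z)
        have h2 : |z ^ 2 - (v : ℝ)| ≤ z ^ 2 + v := by
          rw [abs_le]; constructor <;> nlinarith [sq_nonneg z]
        gcongr
    _ = 2 * K / v * |x - y| * v ^ 2 := by
        rw [integral_const_mul, integral_add ((ExpGrowth.pow 2).integrable v)
          (integrable_const _), integral_sq_gaussianReal]
        simp
        field_simp
        ring

/-- Second order Taylor estimate for a function whose second derivative is Lipschitz. -/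
lemma abs_taylor_two_le_of_nonneg {u u' u'' : ℝ → ℝ} {M : ℝ}
    (h1 : ∀ x, HasDerivAt u (u' x) x) (h2 : ∀ x, HasDerivAt u' (u'' x) x)
    (h3 : ∀ x y, |u'' x - u'' y| ≤ M * |x - y|) (x : ℝ) {y : ℝ} (hy : 0 ≤ y) :
    |u (x + y) - u x - u' x * y - u'' x * y ^ 2 / 2| ≤ M * y ^ 3 / 6 := by
  have hd1 : ∀ t, HasDerivAt (fun t => u' (x + t) - u' x - u'' x * t) (u'' (x + t) - u'' x) t := by
    intro t
    have h := (((h2 (x + t)).comp_const_add x t).sub_const (u' x)).sub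
      ((hasDerivAt_id t).const_mul (u'' x))
    exact h.congr_deriv (by simp)
  have hd0 : ∀ t, HasDerivAt (fun t => u (x + t) - u x - u' x * t - u'' x * t ^ 2 / 2)
      (u' (x + t) - u' x - u'' x * t) t := by
    intro t
    have h := ((((h1 (x + t)).comp_const_add x t).sub_const (u x)).sub
      ((hasDerivAt_id t).const_mul (u' x))).sub
      (((hasDerivAt_pow 2 t).const_mul (u'' x)).div_const 2)
    exact h.congr_deriv (by simp; ring)
  have hb1 : ∀ t, 0 ≤ t → |u' (x + t) - u' x - u'' x * t| ≤ M * t ^ 2 / 2 := by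
    intro t ht
    refine image_norm_le_of_norm_deriv_right_le_deriv_boundary (a := 0) (b := t)
      (f := fun t => u' (x + t) - u' x - u'' x * t) (B := fun t => M * t ^ 2 / 2)
      (B' := fun t => M * t)
      (fun s _ => (hd1 s).continuousAt.continuousWithinAt)
      (fun s _ => (hd1 s).hasDerivWithinAt) (by simp) (fun s => ?_) (fun s hs => ?_)
      (Set.right_mem_Icc.mpr ht)
    · exact (((hasDerivAt_pow 2 s).const_mul M).div_const 2).congr_deriv (by simp; ring)
    · simpa [abs_of_nonneg hs.1] using h3 (x + s) x
  refine image_norm_le_of_norm_deriv_right_le_deriv_boundary (a := 0) (b := y)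
    (f := fun t => u (x + t) - u x - u' x * t - u'' x * t ^ 2 / 2)
    (B := fun t => M * t ^ 3 / 6) (B' := fun t => M * t ^ 2 / 2)
    (fun s _ => (hd0 s).continuousAt.continuousWithinAt)
    (fun s _ => (hd0 s).hasDerivWithinAt) (by simp) (fun s => ?_)
    (fun s hs => hb1 s hs.1) (Set.right_mem_Icc.mpr hy)
  exact (((hasDerivAt_pow 3 s).const_mul M).div_const 6).congr_deriv (by simp; ring)

lemma abs_taylor_two_le {u u' u'' : ℝ → ℝ} {M : ℝ}
    (h1 : ∀ x, HasDerivAt u (u' x) x) (h2 : ∀ x, HasDerivAt u' (u'' x) x)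
    (h3 : ∀ x y, |u'' x - u'' y| ≤ M * |x - y|) (x y : ℝ) :
    |u (x + y) - u x - u' x * y - u'' x * y ^ 2 / 2| ≤ M * |y| ^ 3 / 6 := by
  rcases le_total 0 y with hy | hy
  · rw [abs_of_nonneg hy]; exact abs_taylor_two_le_of_nonneg h1 h2 h3 x hy
  -- Reflection `t ↦ -t` changes the sign of the first derivative only.
  · have h := abs_taylor_two_le_of_nonneg (u := fun t => u (-t)) (u' := fun t => -u' (-t))
      (u'' := fun t => u'' (-t)) (M := M)
      (fun t => ((h1 (-t)).comp t (hasDerivAt_neg t)).congr_deriv (by ring))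
      (fun t => (((h2 (-t)).comp t (hasDerivAt_neg t)).fun_neg).congr_deriv (by ring))
      (fun s t => by
        have := h3 (-s) (-t)
        rwa [show -s - -t = -(s - t) by ring, abs_neg] at this) (-x) (neg_nonneg.mpr hy)
    rw [abs_of_nonpos hy]
    simp only [neg_neg, neg_add_rev] at h
    convert h using 2
    ring_nf

lemma abs_gaussianSmooth_taylor_le (hv : v ≠ 0) (hφ : LipschitzWith K φ) (x y : ℝ) :
    |gaussianSmooth φ v (x + y) - gaussianSmooth φ v x - gaussianSmoothDeriv φ v x * y
      - gaussianSmoothDeriv2 φ v x * y ^ 2 / 2| ≤ 2 * K / v * |y| ^ 3 / 6 :=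
  abs_taylor_two_le (hasDerivAt_gaussianSmooth hv hφ) (hasDerivAt_gaussianSmoothDeriv hv hφ)
    (abs_gaussianSmoothDeriv2_sub_le hv hφ) x y

/-- Midpoint convexity passes to the average. With the Taylor bounds at `x ± y` it gives `0 ≤ b y² +
M y³ / 3`, which fails for small `y > 0` if `b < 0`. -/
lemma gaussianSmoothDeriv2_nonneg (hv : v ≠ 0) (hφ : LipschitzWith K φ)
    (hconv : ConvexOn ℝ Set.univ φ) (x : ℝ) : 0 ≤ gaussianSmoothDeriv2 φ v x := by
  set M : ℝ := 2 * K / v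
  have hM : 0 ≤ M := by positivity
  by_contra! hneg
  set b := gaussianSmoothDeriv2 φ v x
  -- With this `y`, `b y² = -(M + 1) y³` outweighs `M y³ / 3`.
  set y : ℝ := -b / (M + 1) with hy
  have hypos : 0 < y := div_pos (by linarith) (by positivity)
  have t1 := abs_le.mp (abs_gaussianSmooth_taylor_le hv hφ x y)
  have t2 := abs_le.mp (abs_gaussianSmooth_taylor_le hv hφ x (-y))
  rw [abs_neg, abs_of_pos hypos] at t2
  rw [abs_of_pos hypos] at t1
  have hc : 2 * gaussianSmooth φ v x ≤ gaussianSmooth φ v (x + y) + gaussianSmooth φ v (x + -y) := by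
    rw [gaussianSmooth, gaussianSmooth, gaussianSmooth,
      ← integral_add ((ExpGrowth.of_lipschitz hφ _).integrable v)
        ((ExpGrowth.of_lipschitz hφ _).integrable v), ← integral_const_mul]
    refine integral_mono (((ExpGrowth.of_lipschitz hφ _).integrable v).const_mul 2)
      (((ExpGrowth.of_lipschitz hφ _).integrable v).add
        ((ExpGrowth.of_lipschitz hφ _).integrable v)) fun z => ?_
    have h := hconv.2 (Set.mem_univ (x + y + z)) (Set.mem_univ (x + -y + z))
      (by norm_num : (0 : ℝ) ≤ 1 / 2) (by norm_num : (0 : ℝ) ≤ 1 / 2) (by norm_num)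
    simp only [smul_eq_mul] at h
    rw [show 1 / 2 * (x + y + z) + 1 / 2 * (x + -y + z) = x + z by ring] at h
    show 2 * φ (x + z) ≤ φ (x + y + z) + φ (x + -y + z)
    linarith
  have key : 0 ≤ b * y ^ 2 + M * y ^ 3 / 3 := by
    have := t1.2
    have := t2.2
    simp only [b, M] at *
    nlinarith
  have hb : b = -((M + 1) * y) := by rw [hy]; field_simp
  rw [hb] at key
  have : 0 < y ^ 3 := by positivity
  nlinarith [mul_nonneg hM this.le]

end Smoothing
/-! ### Elementary properties of the upper expectation -/

section UpperExp

variable {Ω Θ : Type*} [MeasurableSpace Ω] {P : Θ → Measure Ω}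

/-- The bound `C` is essential: a real supremum over an unbounded set takes the default value 0. -/
lemma integral_le_upperExp {X : Ω → ℝ} {C : ℝ} (hC : ∀ θ, ∫ ω, X ω ∂(P θ) ≤ C) (θ : Θ) :
    ∫ ω, X ω ∂(P θ) ≤ upperExp P X :=
  le_ciSup (f := fun θ => ∫ ω, X ω ∂(P θ)) ⟨C, by rintro _ ⟨θ, rfl⟩; exact hC θ⟩ θ

lemma upperExp_const_mul {c : ℝ} (hc : 0 ≤ c) (X : Ω → ℝ) :
    upperExp P (fun ω => c * X ω) = c * upperExp P X := by
  simp only [upperExp, integral_const_mul, Real.mul_iSup_of_nonneg hc]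

variable [Nonempty Θ]

lemma upperExp_le {X : Ω → ℝ} {C : ℝ} (hC : ∀ θ, ∫ ω, X ω ∂(P θ) ≤ C) : upperExp P X ≤ C :=
  ciSup_le hC

lemma abs_upperExp_sub_le {X Y : Ω → ℝ} {B ε : ℝ} (hB : ∀ θ, ∫ ω, X ω ∂(P θ) ≤ B)
    (h : ∀ θ, |∫ ω, X ω ∂(P θ) - ∫ ω, Y ω ∂(P θ)| ≤ ε) :
    |upperExp P X - upperExp P Y| ≤ ε := by
  have hY : ∀ θ, ∫ ω, Y ω ∂(P θ) ≤ B + ε := fun θ => by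
    linarith [(abs_le.mp (h θ)).1, hB θ]
  have h1 : upperExp P X ≤ upperExp P Y + ε := upperExp_le fun θ => by
    linarith [(abs_le.mp (h θ)).2, integral_le_upperExp hY θ]
  have h2 : upperExp P Y ≤ upperExp P X + ε := upperExp_le fun θ => by
    linarith [(abs_le.mp (h θ)).1, integral_le_upperExp hB θ]
  rw [abs_le]; constructor <;> linarith

variable [∀ θ, IsProbabilityMeasure (P θ)]

lemma upperExp_const (c : ℝ) : upperExp P (fun _ => c) = c := by
  simp [upperExp]

lemma upperExp_const_add {X : Ω → ℝ} {C : ℝ} (hX : ∀ θ, Integrable X (P θ))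
    (hC : ∀ θ, ∫ ω, X ω ∂(P θ) ≤ C) (c : ℝ) :
    upperExp P (fun ω => c + X ω) = c + upperExp P X := by
  have e : ∀ θ, ∫ ω, (c + X ω) ∂(P θ) = c + ∫ ω, X ω ∂(P θ) := fun θ => by
    rw [integral_add (integrable_const _) (hX θ)]; simp
  refine le_antisymm (upperExp_le fun θ => ?_) ?_
  · rw [e]; linarith [integral_le_upperExp hC θ]
  · rw [← le_sub_iff_add_le']
    refine upperExp_le fun θ => ?_
    have := integral_le_upperExp (X := fun ω => c + X ω) (C := c + C)
      (fun θ => by rw [e]; linarith [hC θ]) θ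
    rw [e] at this
    linarith

end UpperExp

/-! ### Uniformly bounded second moments -/

/-- `X` is measurable and has second moments at most `V` under all `P θ`. -/
structure SqBound {Ω Θ : Type*} [MeasurableSpace Ω] (P : Θ → Measure Ω) (X : Ω → ℝ) (V : ℝ) :
    Prop where
  measurable : Measurable X
  integrable_sq : ∀ θ, Integrable (fun ω => X ω ^ 2) (P θ)
  integral_sq_le : ∀ θ, ∫ ω, X ω ^ 2 ∂(P θ) ≤ V

/-- Truncation of `t` to the interval `[-N, N]`. -/
def clamp (N t : ℝ) : ℝ := max (-N) (min t N)

lemma lipschitzWith_clamp (N : ℝ) : LipschitzWith 1 (clamp N) :=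
  (LipschitzWith.id.min_const N).const_max (-N)

lemma abs_clamp_le {N : ℝ} (hN : 0 ≤ N) (t : ℝ) : |clamp N t| ≤ N := by
  rw [clamp, abs_le]
  exact ⟨le_max_left _ _, max_le (by linarith) (min_le_right _ _)⟩

/-- Turns a second moment bound `V` into a truncation error `V / N`, uniformly in `θ`. -/
lemma abs_sub_clamp_le {N : ℝ} (hN : 0 < N) (t : ℝ) : |t - clamp N t| ≤ t ^ 2 / N := by
  rw [le_div_iff₀ hN, clamp]
  rcases le_total t N with h1 | h1
  · rw [min_eq_left h1]
    rcases le_total (-N) t with h2 | h2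
    · rw [max_eq_right h2, sub_self, abs_zero, zero_mul]; positivity
    · rw [max_eq_left h2, abs_of_nonpos (by linarith)]; nlinarith
  · rw [min_eq_right h1, max_eq_right (by linarith), abs_of_nonneg (by linarith)]; nlinarith

lemma SqBound.add {Ω Θ : Type*} [MeasurableSpace Ω] {P : Θ → Measure Ω} {X Y : Ω → ℝ} {V W : ℝ}
    (hX : SqBound P X V) (hY : SqBound P Y W) :
    SqBound P (fun ω => X ω + Y ω) (2 * V + 2 * W) := by
  have hi : ∀ θ, Integrable (fun ω => 2 * X ω ^ 2 + 2 * Y ω ^ 2) (P θ) := fun θ =>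
    ((hX.integrable_sq θ).const_mul 2).add ((hY.integrable_sq θ).const_mul 2)
  have h : ∀ ω, (X ω + Y ω) ^ 2 ≤ 2 * X ω ^ 2 + 2 * Y ω ^ 2 := fun ω => by
    nlinarith [sq_nonneg (X ω - Y ω)]
  have hm := hX.measurable.add hY.measurable
  have hXY : ∀ θ, Integrable (fun ω => (X ω + Y ω) ^ 2) (P θ) := fun θ =>
    (hi θ).mono' (hm.pow_const 2).aestronglyMeasurable
      (ae_of_all _ fun ω => by rw [Real.norm_of_nonneg (sq_nonneg _)]; exact h ω)
  refine ⟨hm, hXY, fun θ => (integral_mono (hXY θ) (hi θ) h).trans ?_⟩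
  rw [integral_add ((hX.integrable_sq θ).const_mul 2) ((hY.integrable_sq θ).const_mul 2),
    integral_const_mul, integral_const_mul]
  linarith [hX.integral_sq_le θ, hY.integral_sq_le θ]

section Moments

variable {Ω Θ : Type*} [MeasurableSpace Ω] {P : Θ → Measure Ω} [∀ θ, IsProbabilityMeasure (P θ)]
  {X Y : Ω → ℝ} {V W : ℝ}

lemma SqBound.const (c : ℝ) : SqBound P (fun _ => c) (c ^ 2) :=
  ⟨measurable_const, fun _ => integrable_const _, fun _ => by simp⟩

lemma SqBound.of_le (hX : SqBound P X V) (hY : Measurable Y) {A B : ℝ} (hB : 0 ≤ B)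
    (h : ∀ ω, Y ω ^ 2 ≤ A + B * X ω ^ 2) : SqBound P Y (A + B * V) := by
  have hi : ∀ θ, Integrable (fun ω => A + B * X ω ^ 2) (P θ) := fun θ =>
    (integrable_const _).add ((hX.integrable_sq θ).const_mul B)
  have hY2 : ∀ θ, Integrable (fun ω => Y ω ^ 2) (P θ) := fun θ =>
    (hi θ).mono' (hY.pow_const 2).aestronglyMeasurable
      (ae_of_all _ fun ω => by rw [Real.norm_of_nonneg (sq_nonneg _)]; exact h ω)
  refine ⟨hY, hY2, fun θ => (integral_mono (hY2 θ) (hi θ) h).trans ?_⟩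
  rw [integral_add (integrable_const _) ((hX.integrable_sq θ).const_mul B), integral_const_mul]
  simp only [integral_const, probReal_univ, smul_eq_mul, one_mul]
  have := mul_le_mul_of_nonneg_left (hX.integral_sq_le θ) hB
  linarith

lemma SqBound.integrable (hX : SqBound P X V) (θ : Θ) : Integrable X (P θ) :=
  ((integrable_const (1 : ℝ)).add (hX.integrable_sq θ)).mono' hX.measurable.aestronglyMeasurable
    (ae_of_all _ fun ω => by
      show |X ω| ≤ 1 + X ω ^ 2
      rw [abs_le]; constructor <;> nlinarith [sq_nonneg (X ω + 1), sq_nonneg (X ω - 1)])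

lemma SqBound.integral_le (hX : SqBound P X V) (θ : Θ) : ∫ ω, X ω ∂(P θ) ≤ 1 + V := by
  calc ∫ ω, X ω ∂(P θ) ≤ ∫ ω, (1 + X ω ^ 2) ∂(P θ) :=
        integral_mono (hX.integrable θ) ((integrable_const _).add (hX.integrable_sq θ))
          fun ω => by
            show X ω ≤ 1 + X ω ^ 2
            nlinarith [sq_nonneg (X ω - 1)]
    _ ≤ 1 + V := by
        rw [integral_add (integrable_const _) (hX.integrable_sq θ)]
        simpa using hX.integral_sq_le θ

lemma SqBound.lipschitz_comp (hX : SqBound P X V) {K : ℝ≥0} {g : ℝ → ℝ}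
    (hg : LipschitzWith K g) :
    SqBound P (fun ω => g (X ω)) (2 * g 0 ^ 2 + 2 * (K : ℝ) ^ 2 * V) := by
  refine hX.of_le (hg.continuous.measurable.comp hX.measurable) (by positivity) fun ω => ?_
  have h1 : |g (X ω) - g 0| ≤ K * |X ω| := by
    simpa [Real.dist_eq] using hg.dist_le_mul (X ω) 0
  have h2 : (g (X ω) - g 0) ^ 2 ≤ (K : ℝ) ^ 2 * X ω ^ 2 := by
    rw [← sq_abs (X ω), ← mul_pow, ← sq_abs (g (X ω) - g 0)]
    gcongr
  show g (X ω) ^ 2 ≤ _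
  nlinarith [sq_nonneg (g (X ω) - 2 * g 0)]

lemma SqBound.abs_integral_sub_clamp_le (hX : SqBound P X V) {N : ℝ} (hN : 0 < N) (θ : Θ) :
    |∫ ω, X ω ∂(P θ) - ∫ ω, clamp N (X ω) ∂(P θ)| ≤ V / N := by
  have hc := (hX.lipschitz_comp (lipschitzWith_clamp N)).integrable θ
  rw [← integral_sub (hX.integrable θ) hc]
  refine abs_integral_le_integral_abs.trans ?_
  calc ∫ ω, |X ω - clamp N (X ω)| ∂(P θ) ≤ ∫ ω, X ω ^ 2 / N ∂(P θ) :=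
        integral_mono ((hX.integrable θ).sub hc).abs ((hX.integrable_sq θ).div_const N)
          fun ω => abs_sub_clamp_le hN (X ω)
    _ ≤ V / N := by
        rw [integral_div]
        gcongr
        exact hX.integral_sq_le θ

/-- Identity in distribution only tests bounded continuous functions, so it is applied to `min (t ^
2) N`; monotone convergence under each `P θ` then removes the cutoff. -/
lemma SqBound.of_identDistributed (hX : SqBound P X V) (hY : Measurable Y)
    (h : IdentDistributed P Y X) : SqBound P Y V := by
  have hmin : ∀ (N : ℕ) θ, ∫ ω, min (Y ω ^ 2) N ∂(P θ) ≤ V := by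
    intro N θ
    let f : ℝ →ᵇ ℝ := BoundedContinuousFunction.ofNormedAddCommGroup
      (fun t => min (t ^ 2) (N : ℝ)) (by fun_prop) N fun t => by
        rw [Real.norm_of_nonneg (le_min (sq_nonneg _) (Nat.cast_nonneg _))]
        exact min_le_right _ _
    have hf : ∀ t, f t = min (t ^ 2) (N : ℝ) := fun t => rfl
    have h1 : ∀ θ, ∫ ω, f (Y ω) ∂(P θ) ≤ N := by
      intro θ
      refine (integral_mono_of_nonneg (g := fun _ => (N : ℝ)) (ae_of_all _ fun ω => ?_)
        (integrable_const _) (ae_of_all _ fun ω => min_le_right _ _)).trans (by simp)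
      exact le_min (sq_nonneg _) (Nat.cast_nonneg _)
    have : Nonempty Θ := ⟨θ⟩
    calc ∫ ω, min (Y ω ^ 2) N ∂(P θ) = ∫ ω, f (Y ω) ∂(P θ) := rfl
      _ ≤ upperExp P (fun ω => f (Y ω)) := integral_le_upperExp h1 θ
      _ = upperExp P (fun ω => f (X ω)) := h f
      _ ≤ V := upperExp_le fun θ =>
        (integral_mono_of_nonneg (ae_of_all _ fun ω => le_min (sq_nonneg _) (Nat.cast_nonneg _))
          (hX.integrable_sq θ) (ae_of_all _ fun ω => min_le_left _ _)).trans
          (hX.integral_sq_le θ)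
  have hl : ∀ θ, ∫⁻ ω, ENNReal.ofReal (Y ω ^ 2) ∂(P θ) ≤ ENNReal.ofReal V := by
    intro θ
    have ht := lintegral_tendsto_of_tendsto_of_monotone (μ := P θ)
      (f := fun (N : ℕ) ω => ENNReal.ofReal (min (Y ω ^ 2) N))
      (F := fun ω => ENNReal.ofReal (Y ω ^ 2))
      (fun N => (by fun_prop : Measurable _).aemeasurable)
      (ae_of_all _ fun ω a b hab => ENNReal.ofReal_le_ofReal
        (min_le_min le_rfl (by exact_mod_cast hab)))
      (ae_of_all _ fun ω => by
        obtain ⟨M, hM⟩ := exists_nat_ge (Y ω ^ 2)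
        refine tendsto_const_nhds.congr' ?_
        filter_upwards [Filter.eventually_ge_atTop M] with N hN
        rw [min_eq_left (hM.trans (by exact_mod_cast hN))])
    refine le_of_tendsto' ht fun N => ?_
    rw [← ofReal_integral_eq_lintegral_ofReal]
    · exact ENNReal.ofReal_le_ofReal (hmin N θ)
    · refine (integrable_const (N : ℝ)).mono' (by fun_prop) (ae_of_all _ fun ω => ?_)
      rw [Real.norm_of_nonneg (le_min (sq_nonneg _) (Nat.cast_nonneg _))]
      exact min_le_right _ _
    · exact ae_of_all _ fun ω => le_min (sq_nonneg _) (Nat.cast_nonneg _)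
  have hi : ∀ θ, Integrable (fun ω => Y ω ^ 2) (P θ) := fun θ =>
    ⟨(hY.pow_const 2).aestronglyMeasurable,
      (hasFiniteIntegral_iff_ofReal (ae_of_all _ fun ω => sq_nonneg _)).mpr
        ((hl θ).trans_lt ENNReal.ofReal_lt_top)⟩
  refine ⟨hY, hi, fun θ => ?_⟩
  have hV : 0 ≤ V := (integral_nonneg fun ω => sq_nonneg (X ω)).trans (hX.integral_sq_le θ)
  rw [integral_eq_lintegral_of_nonneg_ae (ae_of_all _ fun ω => sq_nonneg _)
    (hY.pow_const 2).aestronglyMeasurable]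
  exact ENNReal.toReal_le_of_le_ofReal hV (hl θ)

lemma SqBound.const_add (hY : SqBound P Y W) (x : ℝ) :
    SqBound P (fun ω => x + Y ω) (2 * x ^ 2 + 2 * W) :=
  (SqBound.const x).add hY

lemma IsIID.sqBound {n : ℕ} {X : ℕ → Ω → ℝ} (h : IsIID P n X)
    (hX : ∀ i, i < n → Measurable (X i)) (h0 : SqBound P (X 0) W) {i : ℕ} (hi : i < n) :
    SqBound P (X i) W :=
  h0.of_identDistributed (hX i hi) (h.ident i hi)

lemma IsIID.exists_sqBound_sum {n : ℕ} {X : ℕ → Ω → ℝ} (h : IsIID P n X)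
    (hX : ∀ i, i < n → Measurable (X i)) (h0 : SqBound P (X 0) W) {k : ℕ} (hk : k ≤ n) :
    ∃ V, SqBound P (fun ω => ∑ i ∈ Finset.range k, X i ω) V := by
  induction k with
  | zero => exact ⟨0 ^ 2, by simpa using SqBound.const (P := P) 0⟩
  | succ k ih =>
    obtain ⟨V, hV⟩ := ih (by omega)
    exact ⟨_, by simpa only [Finset.sum_range_succ] using hV.add (h.sqBound hX h0 (by omega))⟩

end Moments

/-! ### Independence for Lipschitz functions -/

lemma IsIID.comp {Ω Θ : Type*} [MeasurableSpace Ω] {P : Θ → Measure Ω} {n : ℕ} {X : ℕ → Ω → ℝ} (h : IsIID P n X) {f : ℝ → ℝ} (hf : Continuous f) :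
    IsIID P n (fun i ω => f (X i ω)) where
  ident i hi φ := h.ident i hi (φ.compContinuous ⟨f, hf⟩)
  indep i hi hin φ := h.indep i hi hin (φ.compContinuous
    ⟨fun p : (Fin i → ℝ) × ℝ => (fun j => f (p.1 j), f p.2), by fun_prop⟩)

section Independence

variable {Ω Θ : Type*} [MeasurableSpace Ω] [Nonempty Θ] {P : Θ → Measure Ω}
  [∀ θ, IsProbabilityMeasure (P θ)] {Y₀ : Ω → ℝ} {V W : ℝ} {K : ℝ≥0} {g : ℝ → ℝ}

/-- The one-step operator `x ↦ 𝔼[g(x + Y₀)]`. -/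
noncomputable def stepExp (P : Θ → Measure Ω) (Y₀ : Ω → ℝ) (g : ℝ → ℝ) (x : ℝ) : ℝ :=
  upperExp P (fun ω => g (x + Y₀ ω))

lemma lipschitzWith_stepExp (hY : SqBound P Y₀ W) (hg : LipschitzWith K g) :
    LipschitzWith K (stepExp P Y₀ g) := by
  have hs := fun x => (hY.const_add x).lipschitz_comp hg
  refine LipschitzWith.of_dist_le_mul fun x y => ?_
  rw [Real.dist_eq]
  refine abs_upperExp_sub_le (hs x).integral_le fun θ => ?_
  rw [← integral_sub ((hs x).integrable θ) ((hs y).integrable θ), ← Real.norm_eq_abs]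
  refine (norm_integral_le_of_norm_le_const (C := K * dist x y) (ae_of_all _ fun ω => ?_)).trans
    (by simp)
  simpa [Real.dist_eq] using hg.dist_le_mul (x + Y₀ ω) (y + Y₀ ω)

lemma upperExp_add_eq_upperExp_stepExp {S Y : Ω → ℝ} (hS : SqBound P S V) (hY : SqBound P Y W)
    (hY₀ : SqBound P Y₀ W)
    (h : ∀ f : ℝ →ᵇ ℝ, upperExp P (fun ω => f (S ω + Y ω))
      = upperExp P (fun ω => stepExp P Y₀ f (S ω)))
    (hg : LipschitzWith K g) :
    upperExp P (fun ω => g (S ω + Y ω)) = upperExp P (fun ω => stepExp P Y₀ g (S ω)) := by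
  -- `B` bounds the second moments of `g (S + Y)`, and also the average over `x = S` of the bound
  -- for `g (x + Y₀)`. Truncation at `N` thus costs `B / N` on each side.
  set B : ℝ := 2 * g 0 ^ 2 + 2 * (K : ℝ) ^ 2 * (2 * V + 2 * W) with hBdef
  have hSY := (hS.add hY).lipschitz_comp hg
  have hB : 0 ≤ B := (integral_nonneg fun ω => sq_nonneg _).trans
    (hSY.integral_sq_le (Classical.arbitrary Θ))
  have key : ∀ N : ℝ, 0 < N → |upperExp P (fun ω => g (S ω + Y ω))
      - upperExp P (fun ω => stepExp P Y₀ g (S ω))| ≤ 2 * B / N := by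
    intro N hN
    have hcg : LipschitzWith K (fun t => clamp N (g t)) := by
      simpa [Function.comp_def] using (lipschitzWith_clamp N).comp hg
    let f : ℝ →ᵇ ℝ := BoundedContinuousFunction.ofNormedAddCommGroup
      (fun t => clamp N (g t)) hcg.continuous N fun t => abs_clamp_le hN.le _
    have h1 : |upperExp P (fun ω => g (S ω + Y ω)) - upperExp P (fun ω => f (S ω + Y ω))| ≤ B / N :=
      abs_upperExp_sub_le hSY.integral_le fun θ => hSY.abs_integral_sub_clamp_le hN θ
    have hx : ∀ x, |stepExp P Y₀ g x - stepExp P Y₀ (fun t => clamp N (g t)) x|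
        ≤ (2 * g 0 ^ 2 + 2 * (K : ℝ) ^ 2 * (2 * x ^ 2 + 2 * W)) / N := fun x =>
      abs_upperExp_sub_le ((hY₀.const_add x).lipschitz_comp hg).integral_le fun θ =>
        ((hY₀.const_add x).lipschitz_comp hg).abs_integral_sub_clamp_le hN θ
    have hT1 := hS.lipschitz_comp (lipschitzWith_stepExp hY₀ hg)
    have hT2 := hS.lipschitz_comp (lipschitzWith_stepExp hY₀ hcg)
    have h2 : |upperExp P (fun ω => stepExp P Y₀ g (S ω))
        - upperExp P (fun ω => stepExp P Y₀ f (S ω))| ≤ B / N := by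
      refine abs_upperExp_sub_le hT1.integral_le fun θ => ?_
      have hi : Integrable (fun ω => 2 * (K : ℝ) ^ 2 * (2 * S ω ^ 2 + 2 * W)) (P θ) :=
        (((hS.integrable_sq θ).const_mul 2).add (integrable_const (2 * W))).const_mul _
      have hi' : Integrable (fun ω => 2 * g 0 ^ 2 + 2 * (K : ℝ) ^ 2 * (2 * S ω ^ 2 + 2 * W)) (P θ) :=
        (integrable_const _).add hi
      calc |∫ ω, stepExp P Y₀ g (S ω) ∂(P θ)
            - ∫ ω, stepExp P Y₀ (fun t => clamp N (g t)) (S ω) ∂(P θ)|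
          = |∫ ω, (stepExp P Y₀ g (S ω)
            - stepExp P Y₀ (fun t => clamp N (g t)) (S ω)) ∂(P θ)| := by
            rw [integral_sub (hT1.integrable θ) (hT2.integrable θ)]
        _ ≤ ∫ ω, |stepExp P Y₀ g (S ω)
            - stepExp P Y₀ (fun t => clamp N (g t)) (S ω)| ∂(P θ) := abs_integral_le_integral_abs
        _ ≤ ∫ ω, (2 * g 0 ^ 2 + 2 * (K : ℝ) ^ 2 * (2 * S ω ^ 2 + 2 * W)) / N ∂(P θ) :=
            integral_mono ((hT1.integrable θ).sub (hT2.integrable θ)).abs (hi'.div_const N)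
              fun ω => hx (S ω)
        _ ≤ B / N := by
            rw [integral_div, integral_add (integrable_const _) hi,
              integral_const_mul (2 * (K : ℝ) ^ 2),
              integral_add ((hS.integrable_sq θ).const_mul 2) (integrable_const _),
              integral_const_mul (2 : ℝ) (fun ω => S ω ^ 2)]
            simp only [integral_const, probReal_univ, smul_eq_mul, one_mul]
            rw [hBdef]
            gcongr
            exact hS.integral_sq_le θ
    rw [h f] at h1
    have e : 2 * B / N = B / N + B / N := by ring
    rw [e]
    have := abs_sub_le (upperExp P (fun ω => g (S ω + Y ω)))
      (upperExp P (fun ω => stepExp P Y₀ f (S ω))) (upperExp P (fun ω => stepExp P Y₀ g (S ω)))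
    rw [abs_sub_comm (upperExp P (fun ω => stepExp P Y₀ f (S ω)))] at this
    linarith
  refine eq_of_abs_sub_nonpos (le_of_forall_pos_le_add fun ε hε => ?_)
  rw [zero_add]
  refine (key (2 * B / ε + 1) (by positivity)).trans ?_
  clear_value B
  rw [div_le_iff₀ (by positivity), mul_add ε, mul_div_cancel₀ _ hε.ne']
  linarith

lemma IsIID.upperExp_sum_succ {n : ℕ} {X : ℕ → Ω → ℝ} (h : IsIID P n X)
    (hX : ∀ i, i < n → Measurable (X i)) (h0 : SqBound P (X 0) W) (hg : LipschitzWith K g)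
    {k : ℕ} (hk : k < n) :
    upperExp P (fun ω => g (∑ i ∈ Finset.range (k + 1), X i ω))
      = upperExp P (fun ω => stepExp P (X 0) g (∑ i ∈ Finset.range k, X i ω)) := by
  rcases Nat.eq_zero_or_pos k with rfl | hk0
  · simp [stepExp, upperExp_const]
  obtain ⟨V, hV⟩ := h.exists_sqBound_sum hX h0 hk.le
  simp only [Finset.sum_range_succ]
  refine upperExp_add_eq_upperExp_stepExp hV (h.sqBound hX h0 hk) h0 (fun f => ?_) hg
  have hsum : ∀ ω, ∑ j : Fin k, X j ω = ∑ i ∈ Finset.range k, X i ω := fun ω =>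
    Fin.sum_univ_eq_sum_range (fun i => X i ω) k
  have h1 := h.indep k hk0 hk (f.compContinuous
    ⟨fun p : (Fin k → ℝ) × ℝ => (∑ j, p.1 j) + p.2, by fun_prop⟩)
  simp only [BoundedContinuousFunction.compContinuous_apply, ContinuousMap.coe_mk,
    hsum] at h1
  rw [h1]
  congr 1
  funext ω
  -- With the partial sum frozen at its value at `ω`, the fresh variable `X k` may be replaced by `X
  -- 0`.
  exact h.ident k hk (f.compContinuous ⟨fun y => (∑ i ∈ Finset.range k, X i ω) + y, by fun_prop⟩)

end Independence
/-! ### One Lindeberg step -/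

section Step

variable {Ω Θ : Type*} [MeasurableSpace Ω] [Nonempty Θ] {P : Θ → Measure Ω}
  [∀ θ, IsProbabilityMeasure (P θ)] {Y : Ω → ℝ} {W : ℝ} {K : ℝ≥0} {g : ℝ → ℝ}

/-- The linear term has integral zero under every `P θ`, so it drops out before the supremum is
taken; `hvar` evaluates the quadratic term. -/
lemma abs_stepExp_sub_taylor_le (hY : SqBound P Y W) (hg : LipschitzWith K g)
    {x a b q M m : ℝ} (hM : 0 ≤ M)
    (h3 : ∀ θ, Integrable (fun ω => |Y ω| ^ 3) (P θ)) (hm : ∀ θ, ∫ ω, |Y ω| ^ 3 ∂(P θ) ≤ m)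
    (hmean : ∀ θ, ∫ ω, Y ω ∂(P θ) = 0) (hvar : upperExp P (fun ω => b * Y ω ^ 2) = b * q)
    (ht : ∀ y, |g (x + y) - g x - a * y - b * y ^ 2 / 2| ≤ M * |y| ^ 3 / 6) :
    |stepExp P Y g x - (g x + b * q / 2)| ≤ M * m / 6 := by
  have hgi := (hY.const_add x).lipschitz_comp hg
  have hb : ∀ θ, Integrable (fun ω => 1 / 2 * (b * Y ω ^ 2)) (P θ) := fun θ =>
    ((hY.integrable_sq θ).const_mul b).const_mul _
  have hbB : ∀ θ, ∫ ω, 1 / 2 * (b * Y ω ^ 2) ∂(P θ) ≤ 1 / 2 * (|b| * W) := fun θ => by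
    rw [integral_const_mul, integral_const_mul]
    have h0 : 0 ≤ ∫ ω, Y ω ^ 2 ∂(P θ) := integral_nonneg fun ω => sq_nonneg _
    have := hY.integral_sq_le θ
    have : b * ∫ ω, Y ω ^ 2 ∂(P θ) ≤ |b| * W := by
      calc b * ∫ ω, Y ω ^ 2 ∂(P θ) ≤ |b| * ∫ ω, Y ω ^ 2 ∂(P θ) := by
            gcongr; exact le_abs_self b
        _ ≤ |b| * W := by gcongr
    linarith
  have e : g x + b * q / 2 = upperExp P (fun ω => g x + 1 / 2 * (b * Y ω ^ 2)) := by
    rw [upperExp_const_add hb hbB, upperExp_const_mul (by norm_num), hvar]; ring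
  rw [e]
  refine abs_upperExp_sub_le hgi.integral_le fun θ => ?_
  have hi1 : Integrable (fun ω => g x + 1 / 2 * (b * Y ω ^ 2)) (P θ) :=
    (integrable_const _).add (hb θ)
  have hi2 := (hY.integrable θ).const_mul a
  have e2 : ∫ ω, g (x + Y ω) ∂(P θ) - ∫ ω, (g x + 1 / 2 * (b * Y ω ^ 2)) ∂(P θ)
      = ∫ ω, (g (x + Y ω) - (g x + 1 / 2 * (b * Y ω ^ 2)) - a * Y ω) ∂(P θ) := by
    have hi3 : Integrable (fun ω => g (x + Y ω) - (g x + 1 / 2 * (b * Y ω ^ 2))) (P θ) :=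
      (hgi.integrable θ).sub hi1
    rw [integral_sub hi3 hi2, integral_sub (hgi.integrable θ) hi1,
      integral_const_mul a, hmean]
    ring
  rw [e2]
  refine abs_integral_le_integral_abs.trans ?_
  calc ∫ ω, |g (x + Y ω) - (g x + 1 / 2 * (b * Y ω ^ 2)) - a * Y ω| ∂(P θ)
      ≤ ∫ ω, M * |Y ω| ^ 3 / 6 ∂(P θ) := by
        refine integral_mono (((hgi.integrable θ).sub hi1).sub hi2).abs
          (((h3 θ).const_mul M).div_const 6) fun ω => ?_
        have := ht (Y ω)
        rwa [show g (x + Y ω) - g x - a * Y ω - b * Y ω ^ 2 / 2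
          = g (x + Y ω) - (g x + 1 / 2 * (b * Y ω ^ 2)) - a * Y ω by ring] at this
    _ ≤ M * m / 6 := by
        rw [integral_div, integral_const_mul]
        gcongr
        exact hm θ

lemma abs_stepExp_sub_le (hY : SqBound P Y W) (hg : LipschitzWith K g) {r : ℝ}
    (hr : ∀ θ, ∫ ω, |Y ω| ∂(P θ) ≤ r) (x : ℝ) : |stepExp P Y g x - g x| ≤ K * r := by
  have hgi := (hY.const_add x).lipschitz_comp hg
  rw [← upperExp_const (P := P) (g x)]
  refine abs_upperExp_sub_le hgi.integral_le fun θ => ?_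
  rw [← integral_sub (hgi.integrable θ) (integrable_const _)]
  refine abs_integral_le_integral_abs.trans ?_
  calc ∫ ω, |g (x + Y ω) - g x| ∂(P θ) ≤ ∫ ω, K * |Y ω| ∂(P θ) :=
        integral_mono ((hgi.integrable θ).sub (integrable_const _)).abs
          ((hY.integrable θ).abs.const_mul _) fun ω => by
            simpa [Real.dist_eq] using hg.dist_le_mul (x + Y ω) x
    _ ≤ K * r := by
        rw [integral_const_mul]
        gcongr
        exact hr θ

/-- A one-point family: the Gaussian step becomes a special case of `stepExp`, subject to the same
Taylor estimate. -/
lemma sqBound_gaussianReal (q : ℝ≥0) :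
    SqBound (fun _ : Unit => gaussianReal 0 q) (fun z => z) q :=
  ⟨measurable_id, fun _ => (ExpGrowth.pow 2).integrable q,
    fun _ => (integral_sq_gaussianReal q).le⟩

lemma stepExp_gaussianReal {φ : ℝ → ℝ} (hφ : LipschitzWith K φ) (q v : ℝ≥0) (x : ℝ) :
    stepExp (fun _ : Unit => gaussianReal 0 q) (fun z => z) (gaussianSmooth φ v) x
      = gaussianSmooth φ (q + v) x := by
  rw [gaussianSmooth_add hφ, stepExp, upperExp, ciSup_const]

lemma abs_stepExp_gaussianSmooth_sub_le {φ : ℝ → ℝ} (hφ : LipschitzWith K φ)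
    (hY : SqBound P Y W) {v q : ℝ≥0} (hv : v ≠ 0) {m δ : ℝ}
    (hδ : 0 < δ) (hq : (q : ℝ) = δ ^ 2)
    (h3 : ∀ θ, Integrable (fun ω => |Y ω| ^ 3) (P θ)) (hm : ∀ θ, ∫ ω, |Y ω| ^ 3 ∂(P θ) ≤ m)
    (hmean : ∀ θ, ∫ ω, Y ω ∂(P θ) = 0) (x : ℝ)
    (hvar : upperExp P (fun ω => gaussianSmoothDeriv2 φ v x * Y ω ^ 2)
      = gaussianSmoothDeriv2 φ v x * q) :
    |stepExp P Y (gaussianSmooth φ v) x - gaussianSmooth φ (q + v) x|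
      ≤ 2 * K / v * (m + 2 * δ ^ 3) / 6 := by
  have hM : (0 : ℝ) ≤ 2 * K / v := by positivity
  have ht := abs_gaussianSmooth_taylor_le hv hφ x
  have h1 := abs_stepExp_sub_taylor_le hY (lipschitzWith_gaussianSmooth hφ v) hM h3 hm hmean hvar ht
  have h2 := abs_stepExp_sub_taylor_le (sqBound_gaussianReal q)
    (lipschitzWith_gaussianSmooth hφ v) hM
    (fun _ => by simpa [abs_pow] using (ExpGrowth.pow 3).abs.integrable q)
    (fun _ => integral_abs_cube_gaussianReal_le hδ hq)
    (fun _ => integral_id_gaussianReal) (q := q)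
    (by rw [upperExp, ciSup_const, integral_const_mul, integral_sq_gaussianReal]) ht
  rw [stepExp_gaussianReal hφ] at h2
  rw [abs_le] at *
  constructor <;> linarith [h1.1, h1.2, h2.1, h2.2]

lemma abs_stepExp_sub_gaussianSmooth_le {φ : ℝ → ℝ} (hφ : LipschitzWith K φ)
    (hY : SqBound P Y W) {q : ℝ≥0} {r δ : ℝ} (hδ : 0 < δ) (hq : (q : ℝ) = δ ^ 2)
    (hr : ∀ θ, ∫ ω, |Y ω| ∂(P θ) ≤ r) (x : ℝ) :
    |stepExp P Y φ x - gaussianSmooth φ q x| ≤ K * (r + δ) := by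
  have h1 := abs_stepExp_sub_le hY hφ hr x
  have h2 := abs_stepExp_sub_le (sqBound_gaussianReal q) hφ
    (fun _ => integral_abs_gaussianReal_le hδ hq) x
  have e := stepExp_gaussianReal hφ q 0 x
  rw [gaussianSmooth_zero, add_zero] at e
  rw [e] at h2
  rw [abs_le] at *
  constructor <;> linarith [h1.1, h1.2, h2.1, h2.2]

end Step

/-! ### Summation of the one-step errors -/

lemma sum_inv_sub_le (N : ℕ) :
    ∑ k ∈ Finset.range N, ((N - k : ℕ) : ℝ)⁻¹ ≤ 1 + Real.log (N + 1) := by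
  have h1 : ∑ k ∈ Finset.range N, ((N - k : ℕ) : ℝ)⁻¹ = (harmonic N : ℝ) := by
    rw [← Finset.sum_range_reflect, harmonic]
    push_cast
    refine Finset.sum_congr rfl fun k hk => ?_
    have hk' := Finset.mem_range.mp hk
    rw [show N - (N - 1 - k) = k + 1 by omega]
    push_cast
    rfl
  rw [h1]
  refine (harmonic_le_one_add_log N).trans ?_
  rcases Nat.eq_zero_or_pos N with rfl | hN
  · simp
  · gcongr
    linarith

section Lindeberg

variable {Ω Θ : Type*} [MeasurableSpace Ω] [Nonempty Θ] {P : Θ → Measure Ω}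
  [∀ θ, IsProbabilityMeasure (P θ)]

/-- Normal approximation for standardized variables `ξ` when the upper expectation of
`b * (ξ 0) ^ 2` equals `b` for all second derivatives `b` of the Gaussian smoothings of `φ`. -/
theorem abs_upperExp_sub_integral_gaussianReal_le {n : ℕ} (hn : 1 ≤ n) {ξ : ℕ → Ω → ℝ}
    (hξ : ∀ i, i < n → Measurable (ξ i)) (hiid : IsIID P n ξ) {m r : ℝ}
    (h3 : ∀ θ, Integrable (fun ω => |ξ 0 ω| ^ 3) (P θ))
    (hm : ∀ θ, ∫ ω, |ξ 0 ω| ^ 3 ∂(P θ) ≤ m)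
    (hmean : ∀ θ, ∫ ω, ξ 0 ω ∂(P θ) = 0) (hr : SqBound P (ξ 0) (r ^ 2))
    (hr1 : 1 ≤ r) (hm1 : 1 ≤ m) {K : ℝ≥0} {φ : ℝ → ℝ} (hφ : LipschitzWith K φ)
    (hvar : ∀ v : ℝ≥0, v ≠ 0 → ∀ x, upperExp P (fun ω => gaussianSmoothDeriv2 φ v x * ξ 0 ω ^ 2)
      = gaussianSmoothDeriv2 φ v x) :
    |upperExp P (fun ω => φ ((∑ i ∈ Finset.range n, ξ i ω) / √(n : ℝ)))
        - ∫ z, φ z ∂(gaussianReal 0 1)|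
      ≤ (Real.log n + 1) / √(n : ℝ) * (2 * r + m) * K := by
  obtain ⟨N, rfl⟩ : ∃ N, n = N + 1 := ⟨n - 1, by omega⟩
  set n := N + 1 with hndef
  have hnpos : (0 : ℝ) < n := by positivity
  set δ : ℝ := (√(n : ℝ))⁻¹ with hδdef
  have hδ : 0 < δ := by positivity
  have hδ2 : δ ^ 2 = (n : ℝ)⁻¹ := by
    rw [hδdef, inv_pow, Real.sq_sqrt hnpos.le]
  set q : ℝ≥0 := (n : ℝ≥0)⁻¹ with hqdef
  have hq : (q : ℝ) = δ ^ 2 := by rw [hδ2, hqdef]; simp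
  set Y : ℕ → Ω → ℝ := fun i ω => δ * ξ i ω with hYdef
  have hYiid : IsIID P n Y := hiid.comp (f := fun t => δ * t) (by fun_prop)
  have hYm : ∀ i, i < n → Measurable (Y i) := fun i hi => (hξ i hi).const_mul δ
  have hY0 : SqBound P (Y 0) (0 + δ ^ 2 * r ^ 2) :=
    hr.of_le (hYm 0 (by omega)) (by positivity) fun ω => by
      show (δ * ξ 0 ω) ^ 2 ≤ _
      rw [mul_pow, zero_add]
  have hY3 : ∀ θ, Integrable (fun ω => |Y 0 ω| ^ 3) (P θ) := fun θ => by
    simpa only [hYdef, abs_mul, mul_pow] using (h3 θ).const_mul (|δ| ^ 3)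
  have hYm3 : ∀ θ, ∫ ω, |Y 0 ω| ^ 3 ∂(P θ) ≤ δ ^ 3 * m := fun θ => by
    simp only [hYdef, abs_mul, mul_pow, integral_const_mul, abs_of_pos hδ]
    gcongr
    exact hm θ
  have hYmean : ∀ θ, ∫ ω, Y 0 ω ∂(P θ) = 0 := fun θ => by
    simp only [hYdef, integral_const_mul, hmean, mul_zero]
  have hYabs : ∀ θ, ∫ ω, |Y 0 ω| ∂(P θ) ≤ δ * r := fun θ => by
    simp only [hYdef, abs_mul, integral_const_mul, abs_of_pos hδ]
    gcongr
    -- AM-GM with weight `r` replaces Cauchy–Schwarz for the first absolute moment.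
    have hi := ((hr.integrable_sq θ).div_const (2 * r))
    calc ∫ ω, |ξ 0 ω| ∂(P θ) ≤ ∫ ω, (ξ 0 ω ^ 2 / (2 * r) + r / 2) ∂(P θ) := by
          refine integral_mono (hr.integrable θ).abs (hi.add (integrable_const _)) fun ω => ?_
          have h0 : 0 ≤ (|ξ 0 ω| - r) ^ 2 / (2 * r) := by positivity
          have : ξ 0 ω ^ 2 / (2 * r) + r / 2 - |ξ 0 ω| = (|ξ 0 ω| - r) ^ 2 / (2 * r) := by
            rw [← sq_abs (ξ 0 ω)]; field_simp; ring
          show |ξ 0 ω| ≤ ξ 0 ω ^ 2 / (2 * r) + r / 2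
          linarith
      _ ≤ r := by
          rw [integral_add hi (integrable_const _), integral_div]
          simp only [integral_const, probReal_univ, smul_eq_mul, one_mul]
          have := hr.integral_sq_le θ
          have h : (∫ ω, ξ 0 ω ^ 2 ∂(P θ)) / (2 * r) ≤ r ^ 2 / (2 * r) := by gcongr
          have : r ^ 2 / (2 * r) = r / 2 := by field_simp
          linarith
  have hYvar : ∀ v : ℝ≥0, v ≠ 0 → ∀ x,
      upperExp P (fun ω => gaussianSmoothDeriv2 φ v x * Y 0 ω ^ 2)
        = gaussianSmoothDeriv2 φ v x * q := fun v hv x => by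
    have e : (fun ω => gaussianSmoothDeriv2 φ v x * Y 0 ω ^ 2)
        = fun ω => δ ^ 2 * (gaussianSmoothDeriv2 φ v x * ξ 0 ω ^ 2) := by
      funext ω; simp only [hYdef]; ring
    rw [e, upperExp_const_mul (by positivity), hvar v hv, hq]; ring
  -- The Gaussian variance still to be replaced after `k` steps.
  set w : ℕ → ℝ≥0 := fun k => ((n - k : ℕ) : ℝ≥0) * q with hw
  have hwsucc : ∀ k, k < n → w k = q + w (k + 1) := fun k hk => by
    simp only [hw]
    rw [show n - k = (n - (k + 1)) + 1 by omega]
    push_cast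
    ring
  have hw0 : w 0 = 1 := by
    simp only [hw, hqdef, Nat.sub_zero]
    exact mul_inv_cancel₀ (by positivity)
  have hwn : w n = 0 := by simp [hw]
  set a : ℕ → ℝ := fun k =>
    upperExp P (fun ω => gaussianSmooth φ (w k) (∑ i ∈ Finset.range k, Y i ω)) with ha
  have hstep : ∀ k, k < n → ∀ ε : ℝ,
      (∀ x, |stepExp P (Y 0) (gaussianSmooth φ (w (k + 1))) x - gaussianSmooth φ (w k) x| ≤ ε) →
      |a (k + 1) - a k| ≤ ε := by
    intro k hk ε hε
    obtain ⟨V, hV⟩ := hYiid.exists_sqBound_sum hYm hY0 hk.le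
    have hL := lipschitzWith_gaussianSmooth hφ
    have h1 := hV.lipschitz_comp (lipschitzWith_stepExp hY0 (hL (w (k + 1))))
    have h2 := hV.lipschitz_comp (hL (w k))
    simp only [ha]
    rw [hYiid.upperExp_sum_succ hYm hY0 (hL _) hk]
    refine abs_upperExp_sub_le h1.integral_le fun θ => ?_
    rw [← integral_sub (h1.integrable θ) (h2.integrable θ), ← Real.norm_eq_abs]
    exact (norm_integral_le_of_norm_le_const (C := ε) (ae_of_all _ fun ω => hε _)).trans (by simp)
  -- Here `w n = 0`, where the bound `2 * K / v` is unavailable; first moments of the two steps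
  -- suffice.
  have hlast : |a n - a N| ≤ K * (δ * r + δ) := by
    refine hstep N (by omega) _ fun x => ?_
    have e : w N = q := by rw [hwsucc N (by omega), ← hndef, hwn, add_zero]
    rw [e, ← hndef, hwn, gaussianSmooth_zero]
    exact abs_stepExp_sub_gaussianSmooth_le hφ hY0 hδ hq hYabs x
  have hmid : ∀ k ∈ Finset.range N,
      |a (k + 1) - a k| ≤ K * δ * (m + 2) / 3 * ((N - k : ℕ) : ℝ)⁻¹ := by
    intro k hk
    have hkN := Finset.mem_range.mp hk
    refine hstep k (by omega) _ fun x => ?_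
    have hNk : (0 : ℝ) < ((N - k : ℕ) : ℝ) := by
      exact_mod_cast Nat.sub_pos_of_lt hkN
    have hwk : ((w (k + 1) : ℝ≥0) : ℝ) = ((N - k : ℕ) : ℝ) * δ ^ 2 := by
      simp only [hw, NNReal.coe_mul, hq, NNReal.coe_natCast]
      rw [show n - (k + 1) = N - k by omega]
    have hne : w (k + 1) ≠ 0 := by
      intro h0
      rw [h0] at hwk
      have : (0 : ℝ) < ((N - k : ℕ) : ℝ) * δ ^ 2 := by positivity
      simp only [NNReal.coe_zero] at hwk
      linarith
    rw [hwsucc k (by omega)]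
    refine (abs_stepExp_gaussianSmooth_sub_le hφ hY0 hne hδ hq hY3 hYm3 hYmean x
      (hYvar _ hne x)).trans (le_of_eq ?_)
    rw [hwk]
    field_simp
    ring
  have htel : |a n - a 0| ≤ K * (δ * r + δ) + K * δ * (m + 2) / 3 * (1 + Real.log n) := by
    have h1 : |a N - a 0| ≤ K * δ * (m + 2) / 3 * (1 + Real.log n) := by
      rw [← Finset.sum_range_sub]
      refine (Finset.abs_sum_le_sum_abs _ _).trans ((Finset.sum_le_sum hmid).trans ?_)
      rw [← Finset.mul_sum]
      have := sum_inv_sub_le N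
      have hc : ((n : ℕ) : ℝ) = N + 1 := by rw [hndef]; push_cast; rfl
      rw [hc]
      gcongr
    have := abs_sub_le (a n) (a N) (a 0)
    linarith
  have han : a n = upperExp P (fun ω => φ ((∑ i ∈ Finset.range n, ξ i ω) / √(n : ℝ))) := by
    simp only [ha, hwn, gaussianSmooth_zero, hYdef, ← Finset.mul_sum]
    simp only [hδdef, div_eq_inv_mul]
  have ha0 : a 0 = ∫ z, φ z ∂(gaussianReal 0 1) := by
    simp only [ha, hw0, Finset.range_zero, Finset.sum_empty, upperExp_const, gaussianSmooth,
      zero_add]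
  rw [← han, ← ha0]
  refine htel.trans ?_
  have hlog : 0 ≤ Real.log n := Real.log_natCast_nonneg n
  -- The slack in the claimed constant, written so that `1 ≤ r` and `1 ≤ m` make each summand
  -- nonnegative.
  have e : (Real.log n + 1) / √(n : ℝ) * (2 * r + m) * K
      - (K * (δ * r + δ) + K * δ * (m + 2) / 3 * (1 + Real.log n))
      = K * δ * ((r - 1) + 2 * r * Real.log n + 2 * (m - 1) / 3 * (1 + Real.log n)) := by
    rw [hδdef]
    field_simp
    ring
  have h0 : 0 ≤ K * δ * ((r - 1) + 2 * r * Real.log n + 2 * (m - 1) / 3 * (1 + Real.log n)) := by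
    have : 0 ≤ r - 1 := by linarith
    have : 0 ≤ m - 1 := by linarith
    positivity
  linarith

end Lindeberg

/-! ### The Lipschitz constant and the supremum of the derivative -/

lemma derivSupNorm_nonneg (φ : ℝ → ℝ) : 0 ≤ derivSupNorm φ :=
  Real.iSup_nonneg fun _ => abs_nonneg _

/-- A Lipschitz function is absolutely continuous, hence the integral of its derivative. -/
lemma lipschitzWith_derivSupNorm {K : ℝ≥0} {φ : ℝ → ℝ} (hφ : LipschitzWith K φ) :
    LipschitzWith (derivSupNorm φ).toNNReal φ := by
  have hb : ∀ x, |deriv φ x| ≤ derivSupNorm φ := fun x =>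
    le_ciSup (f := fun x => |deriv φ x|)
      ⟨K, by rintro _ ⟨y, rfl⟩; exact norm_deriv_le_of_lipschitz hφ⟩ x
  refine LipschitzWith.of_dist_le_mul fun x y => ?_
  rw [Real.coe_toNNReal _ (derivSupNorm_nonneg φ), Real.dist_eq, Real.dist_eq,
    ← ((hφ.lipschitzOnWith).absolutelyContinuousOnInterval (a := y) (b := x)).integral_deriv_eq_sub]
  exact intervalIntegral.norm_integral_le_of_norm_le_const (f := deriv φ) fun t _ => hb t

/-! ### Standardization -/

section Standardization

variable {Ω Θ : Type*} [MeasurableSpace Ω] {P : Θ → Measure Ω}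
  [∀ θ, IsProbabilityMeasure (P θ)]

lemma exists_integral_abs_cube_sub_le {X : Ω → ℝ} (hX : Measurable X)
    (h3 : (⨆ θ, ∫⁻ ω, ‖X ω‖ₑ ^ 3 ∂(P θ)) < ∞) (μ : ℝ) :
    ∃ C : ℝ, ∀ θ, Integrable (fun ω => |X ω - μ| ^ 3) (P θ) ∧ ∫ ω, |X ω - μ| ^ 3 ∂(P θ) ≤ C := by
  set D := ⨆ θ, ∫⁻ ω, ‖X ω‖ₑ ^ 3 ∂(P θ) with hD
  refine ⟨4 * (D.toReal + |μ| ^ 3), fun θ => ?_⟩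
  have hle : ∫⁻ ω, ‖X ω‖ₑ ^ 3 ∂(P θ) ≤ D := le_iSup (fun θ => ∫⁻ ω, ‖X ω‖ₑ ^ 3 ∂(P θ)) θ
  have he : ∀ ω, ENNReal.ofReal (|X ω| ^ 3) = ‖X ω‖ₑ ^ 3 := fun ω => by
    rw [ENNReal.ofReal_pow (abs_nonneg _), Real.enorm_eq_ofReal_abs]
  have hi : Integrable (fun ω => |X ω| ^ 3) (P θ) :=
    ⟨(by fun_prop : Measurable _).aestronglyMeasurable,
      (hasFiniteIntegral_iff_ofReal (ae_of_all _ fun ω => by positivity)).mpr (by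
        simp only [he]; exact hle.trans_lt h3)⟩
  have hint : ∫ ω, |X ω| ^ 3 ∂(P θ) ≤ D.toReal := by
    rw [integral_eq_lintegral_of_nonneg_ae (ae_of_all _ fun ω => by positivity)
      hi.aestronglyMeasurable]
    simp only [he]
    exact ENNReal.toReal_mono h3.ne hle
  have hi2 : Integrable (fun ω => 4 * (|X ω| ^ 3 + |μ| ^ 3)) (P θ) :=
    (hi.add (integrable_const _)).const_mul 4
  have hpt : ∀ ω, |X ω - μ| ^ 3 ≤ 4 * (|X ω| ^ 3 + |μ| ^ 3) := fun ω => by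
    have h1 : |X ω - μ| ≤ |X ω| + |μ| := abs_sub _ _
    calc |X ω - μ| ^ 3 ≤ (|X ω| + |μ|) ^ 3 := by gcongr
      _ ≤ 4 * (|X ω| ^ 3 + |μ| ^ 3) := by
        -- This is exactly `4 (a³ + b³) - (a + b)³` for `a = |X ω|`, `b = |μ|`.
        have h : 0 ≤ 3 * (|X ω| + |μ|) * (|X ω| - |μ|) ^ 2 := by positivity
        nlinarith
  have hi3 : Integrable (fun ω => |X ω - μ| ^ 3) (P θ) :=
    hi2.mono' (by fun_prop : Measurable _).aestronglyMeasurable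
      (ae_of_all _ fun ω => by rw [Real.norm_of_nonneg (by positivity)]; exact hpt ω)
  refine ⟨hi3, (integral_mono hi3 hi2 hpt).trans ?_⟩
  rw [integral_const_mul, integral_add hi (integrable_const _)]
  simp only [integral_const, probReal_univ, smul_eq_mul, one_mul]
  linarith

lemma sqBound_of_integral_abs_cube_le {X : Ω → ℝ} (hX : Measurable X) {C : ℝ}
    (h3 : ∀ θ, Integrable (fun ω => |X ω| ^ 3) (P θ))
    (hC : ∀ θ, ∫ ω, |X ω| ^ 3 ∂(P θ) ≤ C) : SqBound P X (1 + C) := by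
  have hi : ∀ θ, Integrable (fun ω => 1 + |X ω| ^ 3) (P θ) := fun θ =>
    (integrable_const _).add (h3 θ)
  have hpt : ∀ ω, X ω ^ 2 ≤ 1 + |X ω| ^ 3 := fun ω => by
    rw [← sq_abs]
    have := abs_nonneg (X ω)
    rcases le_total |X ω| 1 with h | h
    · have : |X ω| ^ 2 ≤ 1 := pow_le_one₀ this h
      have : 0 ≤ |X ω| ^ 3 := by positivity
      linarith
    · have : |X ω| ^ 2 ≤ |X ω| ^ 3 := pow_le_pow_right₀ h (by norm_num)
      linarith
  have h2 : ∀ θ, Integrable (fun ω => X ω ^ 2) (P θ) := fun θ =>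
    (hi θ).mono' (hX.pow_const 2).aestronglyMeasurable
      (ae_of_all _ fun ω => by rw [Real.norm_of_nonneg (sq_nonneg _)]; exact hpt ω)
  refine ⟨hX, h2, fun θ => (integral_mono (h2 θ) (hi θ) hpt).trans ?_⟩
  rw [integral_add (integrable_const _) (h3 θ)]
  simpa using hC θ

variable [Nonempty Θ]

/-- Normal approximation after standardization by a scale `σ` with `σ ≤ σU`. -/
theorem abs_upperExp_standardized_sub_le {n : ℕ} (hn : 1 ≤ n) {X : ℕ → Ω → ℝ}
    (hX : ∀ i, i < n → Measurable (X i)) (hiid : IsIID P n X)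
    (h3 : (⨆ θ, ∫⁻ ω, ‖X 0 ω‖ₑ ^ 3 ∂(P θ)) < ∞) {μ : ℝ} (hμ : upperExp P (X 0) = μ)
    (hμ' : -upperExp P (fun ω => -X 0 ω) = μ) {σ σU : ℝ} (hσ : 0 < σ) (hσU0 : 0 ≤ σU)
    (hσU : upperExp P (fun ω => (X 0 ω - μ) ^ 2) = σU ^ 2) (hle : σ ^ 2 ≤ σU ^ 2)
    {φ : ℝ → ℝ} (hφ : ∃ K, LipschitzWith K φ)
    (hvar : ∀ v : ℝ≥0, v ≠ 0 → ∀ x,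
      upperExp P (fun ω => gaussianSmoothDeriv2 φ v x * (X 0 ω - μ) ^ 2)
        = gaussianSmoothDeriv2 φ v x * σ ^ 2) :
    |upperExp P (fun ω => φ ((∑ i ∈ Finset.range n, (X i ω - μ)) / (σ * √(n : ℝ))))
        - ∫ z, φ z ∂(gaussianReal 0 1)|
      ≤ (Real.log n + 1) / √(n : ℝ)
          * (2 * (σU / σ) + upperExp P (fun ω => |(X 0 ω - μ) / σ| ^ 3)) * derivSupNorm φ := by
  obtain ⟨K, hK⟩ := hφ
  have hX0 := hX 0 (by omega)
  have hcube : ∀ c : ℝ, ∃ C : ℝ, ∀ θ, Integrable (fun ω => |X 0 ω - c| ^ 3) (P θ) ∧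
      ∫ ω, |X 0 ω - c| ^ 3 ∂(P θ) ≤ C := exists_integral_abs_cube_sub_le hX0 h3
  obtain ⟨C0, hC0⟩ := hcube 0
  simp only [sub_zero] at hC0
  have hXsq : SqBound P (X 0) (1 + C0) :=
    sqBound_of_integral_abs_cube_le hX0 (fun θ => (hC0 θ).1) fun θ => (hC0 θ).2
  have hXneg : SqBound P (fun ω => -X 0 ω) (1 + C0) :=
    sqBound_of_integral_abs_cube_le hX0.neg (fun θ => by simpa using (hC0 θ).1)
      fun θ => by simpa using (hC0 θ).2
  -- Equal upper and lower means force the mean under every single `P θ`.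
  have hmean : ∀ θ, ∫ ω, X 0 ω ∂(P θ) = μ := fun θ => by
    have h1 := integral_le_upperExp hXsq.integral_le θ
    have h2 := integral_le_upperExp hXneg.integral_le θ
    rw [integral_neg] at h2
    linarith
  obtain ⟨C, hC⟩ := hcube μ
  have hWm : Measurable (fun ω => X 0 ω - μ) := hX0.sub_const μ
  have hW' : SqBound P (fun ω => X 0 ω - μ) (1 + C) :=
    sqBound_of_integral_abs_cube_le hWm (fun θ => (hC θ).1) fun θ => (hC θ).2
  have hW : SqBound P (fun ω => X 0 ω - μ) (σU ^ 2) :=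
    ⟨hWm, hW'.integrable_sq, fun θ => hσU ▸ integral_le_upperExp hW'.integral_sq_le θ⟩
  set ξ : ℕ → Ω → ℝ := fun i ω => (X i ω - μ) / σ with hξdef
  have hξ3 : ∀ θ, Integrable (fun ω => |ξ 0 ω| ^ 3) (P θ) := fun θ => by
    simpa only [hξdef, abs_div, div_pow] using (hC θ).1.div_const (|σ| ^ 3)
  have hξC : ∀ θ, ∫ ω, |ξ 0 ω| ^ 3 ∂(P θ) ≤ C / σ ^ 3 := fun θ => by
    simp only [hξdef, abs_div, div_pow, integral_div, abs_of_pos hσ]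
    gcongr
    exact (hC θ).2
  have hξsq : SqBound P (ξ 0) ((σU / σ) ^ 2) :=
    ⟨hWm.div_const σ, fun θ => by
      simpa only [hξdef, div_pow] using (hW.integrable_sq θ).div_const (σ ^ 2), fun θ => by
      simp only [hξdef, div_pow, integral_div]
      gcongr
      exact hW.integral_sq_le θ⟩
  have hr1 : 1 ≤ σU / σ := by
    rw [le_div_iff₀ hσ, one_mul]
    exact (pow_le_pow_iff_left₀ hσ.le hσU0 two_ne_zero).mp hle
  have hξvar : upperExp P (fun ω => ξ 0 ω ^ 2) = (σU / σ) ^ 2 := by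
    have e : (fun ω => ξ 0 ω ^ 2) = fun ω => (σ ^ 2)⁻¹ * (X 0 ω - μ) ^ 2 := by
      funext ω; simp only [hξdef]; rw [div_pow]; ring
    rw [e, upperExp_const_mul (by positivity), hσU, div_pow]; ring
  -- From `3 t² ≤ 2 t³ + 1` for `t ≥ 0`: the upper second moment is at least 1, hence so is the
  -- third.
  have hm1 : 1 ≤ upperExp P (fun ω => |ξ 0 ω| ^ 3) := by
    have h1 : upperExp P (fun ω => ξ 0 ω ^ 2)
        ≤ (2 * upperExp P (fun ω => |ξ 0 ω| ^ 3) + 1) / 3 := by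
      refine upperExp_le fun θ => ?_
      have hi : Integrable (fun ω => 2 * |ξ 0 ω| ^ 3 + 1) (P θ) :=
        ((hξ3 θ).const_mul 2).add (integrable_const _)
      calc ∫ ω, ξ 0 ω ^ 2 ∂(P θ) ≤ ∫ ω, (2 * |ξ 0 ω| ^ 3 + 1) / 3 ∂(P θ) := by
            refine integral_mono (hξsq.integrable_sq θ) (hi.div_const 3) fun ω => ?_
            show ξ 0 ω ^ 2 ≤ (2 * |ξ 0 ω| ^ 3 + 1) / 3
            rw [← sq_abs]
            have h : 0 ≤ (2 * |ξ 0 ω| + 1) * (|ξ 0 ω| - 1) ^ 2 := by positivity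
            nlinarith
        _ ≤ _ := by
            rw [integral_div, integral_add ((hξ3 θ).const_mul 2) (integrable_const _),
              integral_const_mul]
            simp only [integral_const, probReal_univ, smul_eq_mul, mul_one]
            have := integral_le_upperExp hξC θ
            linarith
    rw [hξvar] at h1
    nlinarith
  have hφ' := lipschitzWith_derivSupNorm hK
  have hmain := abs_upperExp_sub_integral_gaussianReal_le hn (ξ := ξ)
    (fun i hi => ((hX i hi).sub_const μ).div_const σ)
    (hiid.comp (f := fun t => (t - μ) / σ) (by fun_prop)) hξ3
    (fun θ => integral_le_upperExp hξC θ)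
    (fun θ => by
      simp only [hξdef, integral_div]
      rw [integral_sub (hXsq.integrable θ) (integrable_const _), hmean]
      simp)
    hξsq hr1 hm1 hφ' fun v hv x => by
      have e : (fun ω => gaussianSmoothDeriv2 φ v x * ξ 0 ω ^ 2)
          = fun ω => (σ ^ 2)⁻¹ * (gaussianSmoothDeriv2 φ v x * (X 0 ω - μ) ^ 2) := by
        funext ω; simp only [hξdef]; rw [div_pow]; ring
      rw [e, upperExp_const_mul (by positivity), hvar v hv]
      field_simp
  rw [Real.coe_toNNReal _ (derivSupNorm_nonneg φ)] at hmain
  have e : ∀ ω, (∑ i ∈ Finset.range n, (X i ω - μ)) / (σ * √(n : ℝ))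
      = (∑ i ∈ Finset.range n, ξ i ω) / √(n : ℝ) := fun ω => by
    simp only [hξdef]
    rw [← Finset.sum_div, div_div]
  simp only [e]
  exact hmain

lemma gaussianSmoothDeriv2_neg (φ : ℝ → ℝ) (v : ℝ≥0) (x : ℝ) :
    gaussianSmoothDeriv2 (fun t => -φ t) v x = -gaussianSmoothDeriv2 φ v x := by
  simp only [gaussianSmoothDeriv2, neg_mul, integral_neg, neg_div]

lemma gaussianSmoothDeriv2_nonpos {K v : ℝ≥0} (hv : v ≠ 0) {φ : ℝ → ℝ} (hφ : LipschitzWith K φ)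
    (hconc : ConcaveOn ℝ Set.univ φ) (x : ℝ) : gaussianSmoothDeriv2 φ v x ≤ 0 := by
  have h := gaussianSmoothDeriv2_nonneg hv hφ.neg hconc.neg x
  have e : (-φ) = fun t => -φ t := rfl
  rw [e, gaussianSmoothDeriv2_neg] at h
  linarith

end Standardization

end SublinearExpectation

/-! ### The convex and the concave case -/

theorem corollary3p2 {Ω Θ : Type*} [MeasurableSpace Ω] [Nonempty Θ]
    (P : Θ → Measure Ω) [∀ θ, IsProbabilityMeasure (P θ)]
    (n : ℕ) (hn : 1 ≤ n)
    -- the variables `X₁, …, Xₙ` of the text are `X 0, …, X (n - 1)`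
    (X : ℕ → Ω → ℝ) (hX : ∀ i, i < n → Measurable (X i))
    (hiid : SublinearExpectation.IsIID P n X)
    (h3 : (⨆ θ, ∫⁻ ω, ‖X 0 ω‖ₑ ^ 3 ∂(P θ)) < ∞)
    (μ : ℝ)
    (hμ : SublinearExpectation.upperExp P (X 0) = μ)
    (hμ' : -SublinearExpectation.upperExp P (fun ω => -X 0 ω) = μ)
    (σU σL : ℝ) (hσU0 : 0 ≤ σU) (hσL0 : 0 ≤ σL)
    (hσU : SublinearExpectation.upperExp P (fun ω => (X 0 ω - μ) ^ 2) = σU ^ 2)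
    (hσL : -SublinearExpectation.upperExp P (fun ω => -(X 0 ω - μ) ^ 2) = σL ^ 2)
    (φ : ℝ → ℝ) (hφ : ∃ K, LipschitzWith K φ) :
    (0 < σU → ConvexOn ℝ Set.univ φ →
      |SublinearExpectation.upperExp P
            (fun ω => φ ((∑ i ∈ Finset.range n, (X i ω - μ)) / (σU * √(n : ℝ))))
          - ∫ z, φ z ∂(gaussianReal 0 1)|
        ≤ (Real.log n + 1) / √(n : ℝ)
            * (2 + SublinearExpectation.upperExp P (fun ω => |(X 0 ω - μ) / σU| ^ 3))
            * SublinearExpectation.derivSupNorm φ) ∧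
    (0 < σL → ConcaveOn ℝ Set.univ φ →
      |SublinearExpectation.upperExp P
            (fun ω => φ ((∑ i ∈ Finset.range n, (X i ω - μ)) / (σL * √(n : ℝ))))
          - ∫ z, φ z ∂(gaussianReal 0 1)|
        ≤ (Real.log n + 1) / √(n : ℝ)
            * (2 * σU / σL
                + SublinearExpectation.upperExp P (fun ω => |(X 0 ω - μ) / σL| ^ 3))
            * SublinearExpectation.derivSupNorm φ) := by
  obtain ⟨K, hK⟩ := hφ
  refine ⟨fun hσ hconv => ?_, fun hσ hconc => ?_⟩
  · have h := SublinearExpectation.abs_upperExp_standardized_sub_le hn hX hiid h3 hμ hμ' hσ hσU0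
      hσU le_rfl ⟨K, hK⟩ fun v hv x => by
        rw [SublinearExpectation.upperExp_const_mul
          (SublinearExpectation.gaussianSmoothDeriv2_nonneg hv hK hconv x), hσU]
    rwa [div_self hσ.ne', mul_one] at h
  · obtain ⟨C, hC⟩ := SublinearExpectation.exists_integral_abs_cube_sub_le (hX 0 (by omega)) h3 μ
    have hW := SublinearExpectation.sqBound_of_integral_abs_cube_le
      ((hX 0 (by omega)).sub_const μ) (fun θ => (hC θ).1) fun θ => (hC θ).2
    -- The variance under any one `P θ` lies between the two.
    have hle : σL ^ 2 ≤ σU ^ 2 := by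
      obtain ⟨θ⟩ := ‹Nonempty Θ›
      have h1 := SublinearExpectation.integral_le_upperExp hW.integral_sq_le θ
      have h2 := SublinearExpectation.integral_le_upperExp (P := P)
        (X := fun ω => -(X 0 ω - μ) ^ 2) (C := 0)
        (fun θ => integral_nonpos fun ω => neg_nonpos.mpr (sq_nonneg _)) θ
      rw [integral_neg] at h2
      linarith
    have h := SublinearExpectation.abs_upperExp_standardized_sub_le hn hX hiid h3 hμ hμ' hσ hσU0
      hσU hle ⟨K, hK⟩ fun v hv x => by
        have hb := SublinearExpectation.gaussianSmoothDeriv2_nonpos hv hK hconc x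
        -- Only nonnegative factors leave `𝔼`; moving the sign onto the square brings in the lower
        -- variance.
        have e : (fun ω => SublinearExpectation.gaussianSmoothDeriv2 φ v x * (X 0 ω - μ) ^ 2)
            = fun ω => -SublinearExpectation.gaussianSmoothDeriv2 φ v x
              * -(X 0 ω - μ) ^ 2 := by
          funext ω; ring
        rw [e, SublinearExpectation.upperExp_const_mul (neg_nonneg.mpr hb), ← hσL]
        ring
    rwa [← mul_div_assoc] at h
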